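/- Let $d\ge 3$ and let $\frac{du}{dt}=F(u):=-Au-B(u,u)+f$ be the Lorenz '96 model on $\mathbb R^d$, i.e. $A=I$, $f=(8,\dots,8)$ and $$B(u,\tilde u)_i=-\tfrac12\left(\tilde u_{i-1}u_{i+1}+u_{i-1}\tilde u_{i+1}-\tilde u_{i-2}u_{i-1}-u_{i-2}\tilde u_{i-1}\right),$$ with indices modulo $d$. Let $R>0$ satisfy the trapping ball assumption: for some $\delta>0$, $\langle F(v),v\rangle\le 0$ whenever $\|v\|\in[R,R+\delta]$. Let $\mathcal B_R=\{v:\|v\|\le R\}$, let $\Psi_t$ $(t\ge0)$ be the solution semigroup, write $u(t)=\Psi_t(u)$, let $\Psi_{-t}:\Psi_t(\mathcal B_R)\to\mathcal B_R$ be the inverse of $\Psi_t|_{\mathcal B_R}$, and let $D^iv=\frac{d^i}{dt^i}\Psi_t(v)\big|_{t=0}$. Let $H$ be the $d_o\times d$ matrix ($d_o\ge3$) with $H_{11}=H_{22}=H_{33}=1$ and all other entries $0$. With $h>0$ and $t_i=ih$, the observations are $Y_i=Hu(t_i)+Z_i$, where the $Z_i$ are i.i.d. centered random vectors in $\mathbb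 R^{d_o}$ whose law has a Lebesgue density $\eta$. For a prior probability density $q$ vanishing outside $\mathcal B_R$, the smoothing density is $$\mu^{\rm sm}(v|Y_0,\dots,Y_k)\propto\prod_{i=0}^k\eta(Y_i-H\Psi_{t_i}(v))\,q(v)\ \text{ on }\mathcal B_R,\quad 0\text{ elsewhere},$$ and the filtering density is $$\mu^{\rm fi}(v|Y_0,\dots,Y_k)\propto\prod_{i=0}^k\eta(Y_i-H\Psi_{t_i-t_k}(v))\,\det(J\Psi_{-t_k}(v))\,q(\Psi_{-t_k}(v))\ \text{ on }\Psi_{t_k}(\mathcal B_R),\quad 0\text{ elsewhere}.$$ The support of such a density is the set where it is non-zero. Let $\mathcal G$ be the set of all $u$ with $\|u\|<R$ and $u_i\ne0$ for all $i$. Then Lebesgue almost every point of $\mathcal B_R$ lies in $\mathcal G$, and the following hold. 1. For every $u\in\mathcal G$ and every $j\ge d-3$: the only $v\in\mathcal B_R$ with $HD^iv=HD^iu$ for all $0\le i\le j$ is $v=u$, and the gradients at $u$ of the functions $w\mapsto(HD^iw)_l$, $0\le i\le j$, $1\le l\le d_o$, span $\mathbb R^d$. 2. For every $u\in\mathcal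 G$ there is $h_0>0$ such that for all $0<h<h_0$ and all $k\ge d-3$ there are finite constants $C_{\rm sm},C_{\rm fi}$ such that, for every $\varepsilon>0$, every noise with $\|Z_i\|\le\varepsilon$ almost surely (with the version of $\eta$ chosen to vanish on $\{\|z\|>\varepsilon\}$) and every prior $q$, almost surely $$\operatorname{diam}\operatorname{supp}\mu^{\rm sm}(\cdot|Y_0,\dots,Y_k)\le C_{\rm sm}\,\varepsilon,\qquad \operatorname{diam}\operatorname{supp}\mu^{\rm fi}(\cdot|Y_0,\dots,Y_k)\le C_{\rm fi}\,\varepsilon.$$ 3. There are measurable estimators $U_{\rm sm}(Y_0,\dots,Y_k)$ and $U_{\rm fi}(Y_0,\dots,Y_k)$, depending (besides on $d,d_o,R$) only on $h$ and $k$, and in particular neither on $u$ nor on the noise distribution, such that for every $u\in\mathcal G$ there is $h_0>0$ such that for all $0<h<h_0$ and all $k\ge d-3$ there are finite constants $D_{\rm sm},D_{\rm fi}$ such that, for every noise with $\sigma_Z^2:=\mathbb E\|Z_i\|^2<\infty$, $$\mathbb E\|U_{\rm sm}(Y_0,\dots,Y_k)-u\|^2\le D_{\rm sm}\,\sigma_Z^2,\qquad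 \mathbb E\|U_{\rm fi}(Y_0,\dots,Y_k)-u(t_k)\|^2\le D_{\rm fi}\,\sigma_Z^2.$$ -/

import Mathlib

open MeasureTheory ProbabilityTheory
open scoped ENNReal NNReal InnerProductSpace

noncomputable section

namespace ObservedODE

/-- Euclidean space `ℝⁿ`. -/
abbrev Vec (n : ℕ) : Type := EuclideanSpace ℝ (Fin n)

/-! ### Dynamics of an autonomous equation `dx/dt = F x` -/

/-- `x` solves `dx/dt = F x` on `[0, ∞)` with `x 0 = v` (one-sided derivative at `t = 0`). -/
def IsForwardSolution {d : ℕ} (F : Vec d → Vec d) (v : Vec d) (x : ℝ → Vec d) : Prop :=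
  x 0 = v ∧ ∀ t : ℝ, 0 ≤ t → HasDerivWithinAt x (F (x t)) (Set.Ici 0) t

/-- The solution semigroup `Ψ_t v`, `t ≥ 0`: the value at time `t` of the solution started
from `v` (of no meaning when there is no forward solution, or for `t < 0`). -/
def flow {d : ℕ} (F : Vec d → Vec d) (t : ℝ) (v : Vec d) : Vec d :=
  Classical.epsilon (IsForwardSolution F v) t

/-- `D^i v`, the `i`-th time derivative at time `0` of the solution started from `v`. -/
def timeDeriv {d : ℕ} (F : Vec d → Vec d) (i : ℕ) (v : Vec d) : Vec d :=
  iteratedDerivWithin i (fun t => flow F t v) (Set.Ici 0) 0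

/-- The closed ball `B_R`. -/
def ballR (d : ℕ) (R : ℝ) : Set (Vec d) := {v | ‖v‖ ≤ R}

/-- The trapping ball assumption: `⟨F v, v⟩ ≤ 0` whenever `‖v‖ ∈ [R, R + δ]`, for some `δ > 0`. -/
def TrappingBall {d : ℕ} (F : Vec d → Vec d) (R : ℝ) : Prop :=
  0 < R ∧ ∃ δ : ℝ, 0 < δ ∧ ∀ v : Vec d, R ≤ ‖v‖ → ‖v‖ ≤ R + δ → ⟪F v, v⟫_ℝ ≤ 0

/-- `Ψ_{-t}`, the inverse of the map `Ψ_t : B_R → Ψ_t(B_R)`. -/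
def flowInv {d : ℕ} (F : Vec d → Vec d) (R t : ℝ) : Vec d → Vec d :=
  Function.invFunOn (flow F t) (ballR d R)

/-! ### Observations -/

/-- The linear observation operator given by a matrix. -/
def observe {d p : ℕ} (H : Matrix (Fin p) (Fin d) ℝ) (v : Vec d) : Vec p :=
  WithLp.toLp 2 (H.mulVec v.ofLp)

/-- The assumption on the derivatives at the point `u`, with index `j`: `‖u‖ < R`; the system
`H D^i u = H D^i v`, `0 ≤ i ≤ j`, has `v = u` as its only solution in `B_R`; and the gradients
at `u` of the coordinates of `H D^i`, `0 ≤ i ≤ j`, span the whole space. -/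
def DerivAssumption {d p : ℕ} (F : Vec d → Vec d) (H : Matrix (Fin p) (Fin d) ℝ) (R : ℝ)
    (j : ℕ) (u : Vec d) : Prop :=
  ‖u‖ < R ∧
  (∀ v ∈ ballR d R,
    (∀ i ≤ j, observe H (timeDeriv F i u) = observe H (timeDeriv F i v)) → v = u) ∧
  Submodule.span ℝ {g : Vec d | ∃ i ≤ j, ∃ k : Fin p,
    g = gradient (fun w : Vec d => observe H (timeDeriv F i w) k) u} = ⊤

/-- `Z₀, Z₁, …` are i.i.d. centered random vectors whose common law has density `η` with respect
to Lebesgue measure. -/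
structure IsNoise {Ω : Type*} [MeasurableSpace Ω] (P : Measure Ω) {p : ℕ}
    (Z : ℕ → Ω → Vec p) (η : Vec p → ℝ≥0∞) : Prop where
  measurable : ∀ i, Measurable (Z i)
  indep : iIndepFun Z P
  measurable_density : Measurable η
  law : ∀ i, P.map (Z i) = volume.withDensity η
  integrable : ∀ i, Integrable (Z i) P
  centered : ∀ i, ∫ ω, Z i ω ∂P = 0

/-- `q` is a probability density with respect to Lebesgue measure that vanishes outside `B_R`. -/
structure IsPrior {d : ℕ} (R : ℝ) (q : Vec d → ℝ≥0∞) : Prop where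
  measurable : Measurable q
  lintegral_eq_one : ∫⁻ v, q v = 1
  eq_zero : ∀ v, v ∉ ballR d R → q v = 0

/-- The observations `Y_i = H u(t_i) + Z_i`, `0 ≤ i ≤ k`, at the times `t_i = i h`, for the
realisation `z = (Z_i)` of the noise. -/
def observations {d p : ℕ} (F : Vec d → Vec d) (H : Matrix (Fin p) (Fin d) ℝ) (h : ℝ) (k : ℕ)
    (u : Vec d) (z : ℕ → Vec p) : Fin (k + 1) → Vec p :=
  fun i => observe H (flow F ((i : ℕ) * h) u) + z i

/-! ### Smoothing and filtering densities -/

/-- `∏_{i ≤ k} η(Y_i - H Ψ_{t_i}(v)) · q(v)` on `B_R`, and `0` elsewhere. -/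
def smootherWeight {d p : ℕ} (F : Vec d → Vec d) (H : Matrix (Fin p) (Fin d) ℝ) (R h : ℝ) (k : ℕ)
    (η : Vec p → ℝ≥0∞) (q : Vec d → ℝ≥0∞) (Y : Fin (k + 1) → Vec p) : Vec d → ℝ≥0∞ :=
  (ballR d R).indicator fun v =>
    (∏ i : Fin (k + 1), η (Y i - observe H (flow F ((i : ℕ) * h) v))) * q v

/-- The density of the smoother, `μ^sm(v | Y₀, …, Y_k)`. -/
def smootherDensity {d p : ℕ} (F : Vec d → Vec d) (H : Matrix (Fin p) (Fin d) ℝ) (R h : ℝ) (k : ℕ)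
    (η : Vec p → ℝ≥0∞) (q : Vec d → ℝ≥0∞) (Y : Fin (k + 1) → Vec p) (v : Vec d) : ℝ≥0∞ :=
  smootherWeight F H R h k η q Y v / ∫⁻ w, smootherWeight F H R h k η q Y w

/-- `∏_{i ≤ k} η(Y_i - H Ψ_{t_i - t_k}(v)) · det(J Ψ_{-t_k}(v)) · q(Ψ_{-t_k}(v))` on
`Ψ_{t_k}(B_R)`, and `0` elsewhere. -/
def filterWeight {d p : ℕ} (F : Vec d → Vec d) (H : Matrix (Fin p) (Fin d) ℝ) (R h : ℝ) (k : ℕ)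
    (η : Vec p → ℝ≥0∞) (q : Vec d → ℝ≥0∞) (Y : Fin (k + 1) → Vec p) : Vec d → ℝ≥0∞ :=
  (flow F (k * h) '' ballR d R).indicator fun v =>
    (∏ i : Fin (k + 1), η (Y i - observe H (flowInv F R (k * h - (i : ℕ) * h) v))) *
      ENNReal.ofReal
        (fderivWithin ℝ (flowInv F R (k * h)) (flow F (k * h) '' ballR d R) v).det *
      q (flowInv F R (k * h) v)

/-- The density of the filter, `μ^fi(v | Y₀, …, Y_k)`. -/
def filterDensity {d p : ℕ} (F : Vec d → Vec d) (H : Matrix (Fin p) (Fin d) ℝ) (R h : ℝ) (k : ℕ)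
    (η : Vec p → ℝ≥0∞) (q : Vec d → ℝ≥0∞) (Y : Fin (k + 1) → Vec p) (v : Vec d) : ℝ≥0∞ :=
  filterWeight F H R h k η q Y v / ∫⁻ w, filterWeight F H R h k η q Y w

/-! ### The Lorenz 96 model -/

/-- The linear part `A = I`. -/
def lorenzA (d : ℕ) : Vec d →ₗ[ℝ] Vec d := LinearMap.id

/-- The nonlinearity `B(u, w)` of the Lorenz 96 model; indices in `Fin d` are cyclic. -/
def lorenzB (d : ℕ) [NeZero d] (u w : Vec d) : Vec d :=
  WithLp.toLp 2 fun i : Fin d =>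
    -(1 / 2 : ℝ) * (w (i - 1) * u (i + 1) + u (i - 1) * w (i + 1)
      - w (i - 2) * u (i - 1) - u (i - 2) * w (i - 1))

/-- The constant forcing `(8, …, 8)`. -/
def lorenzForcing (d : ℕ) : Vec d := WithLp.toLp 2 fun _ => 8

/-- The right-hand side `-A v - B(v, v) + f` of the Lorenz 96 model. -/
def lorenz96 (d : ℕ) [NeZero d] (v : Vec d) : Vec d :=
  -lorenzA d v - lorenzB d v v + lorenzForcing d

/-- The `p × d` matrix with `H₁₁ = H₂₂ = H₃₃ = 1` and all other entries `0`. -/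
def firstThree (p d : ℕ) : Matrix (Fin p) (Fin d) ℝ :=
  fun i k => if (i : ℕ) = k ∧ (i : ℕ) < 3 then 1 else 0

/-- The initial points considered: interior points of `B_R` without vanishing coordinate. -/
def goodPoints (d : ℕ) (R : ℝ) : Set (Vec d) := {u | ‖u‖ < R ∧ ∀ i, u i ≠ 0}

end ObservedODE

end

namespace ObservedODE

open Set Filter Topology

/-! ### Forward solutions -/

section ForwardSolution

variable {d : ℕ} {F : Vec d → Vec d} {u v : Vec d} {x y : ℝ → Vec d} {r : ℝ}

/-! Everything rests on one stability estimate. If `u` has no vanishing coordinate, then every `v`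
in the ball satisfies `‖v - u‖ ≤ C * derivGap d j u v` for `j ≥ d - 3`
(`exists_norm_sub_le_derivGap`). The equation for `u_i` expresses `u_{i-1} u_{i+1}` through `u_i'`,
`u_i`, `u_{i-1}` and `u_{i-2}`. Starting from three known coordinates, division by `u_{i-1}`
therefore yields the next one at the price of one time derivative, and `d - 3` steps reach all of
them. The division is harmless even where `v_{i-1} = 0`, because the identity `f(u)(g(v) - g(u)) =
((fg)(v) - (fg)(u)) - g(v)(f(v) - f(u))` only needs `f(u) ≠ 0` (`Controlled.of_mul`).

A vanishing gap gives uniqueness in the derivative assumption. A vector `w` orthogonal to all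
gradients makes the gap at `u + s w` of size `o(s)`, so `s w = o(s)` and `w = 0`; hence the
gradients span.

For discrete observations, the difference of two trajectories is Taylor expanded. Inverting a
Vandermonde matrix recovers its derivatives from the values at `0, h, …, j h`, with an error `O(h)
‖v - u‖` that is absorbed for small `h` (`exists_norm_sub_le_observe`). Bounded noise then confines
the supports to points with nearly the same observations as `u`. For square integrable noise, least
squares over the ball fits the data at least as well as `u` does, and needs no knowledge of `u` or
of the noise law. Filtering follows by transporting with the flow, which is Lipschitz and injective
on the invariant ball. -/

lemma IsForwardSolution.continuousOn (hx : IsForwardSolution F v x) :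
    ContinuousOn x (Ici 0) := fun t ht => (hx.2 t ht).continuousWithinAt

lemma IsForwardSolution.hasDerivWithinAt_Ici (hx : IsForwardSolution F v x) {t : ℝ}
    (ht : 0 ≤ t) : HasDerivWithinAt x (F (x t)) (Ici t) t :=
  (hx.2 t ht).mono (Ici_subset_Ici.2 ht)

lemma IsForwardSolution.hasDerivAt (hx : IsForwardSolution F v x) {t : ℝ} (ht : 0 < t) :
    HasDerivAt x (F (x t)) t :=
  (hx.2 t ht.le).hasDerivAt (Ici_mem_nhds ht)

/-- If the vector field does not point outwards outside of the open ball of radius `r`, then the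
closed ball of radius `r` is forward invariant. -/
lemma IsForwardSolution.norm_le (hx : IsForwardSolution F v x)
    (hF : ∀ w, r ≤ ‖w‖ → ⟪F w, w⟫_ℝ ≤ 0) (hv : ‖v‖ ≤ r) {t : ℝ} (ht : 0 ≤ t) : ‖x t‖ ≤ r := by
  have hr : 0 ≤ r := (norm_nonneg v).trans hv
  -- The comparison theorem needs a strict inequality of slopes at contact, but the field may be
  -- tangent to the sphere; hence a barrier of slope `ε`, with `ε → 0` afterwards.
  have key : ∀ ε > 0, ‖x t‖ ^ 2 ≤ r ^ 2 + ε * t := by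
    intro ε hε
    have hder : ∀ s ∈ Ico 0 t,
        HasDerivWithinAt (fun s => ‖x s‖ ^ 2) (2 * ⟪x s, F (x s)⟫_ℝ) (Ici s) s :=
      fun s hs => (hx.hasDerivWithinAt_Ici hs.1).norm_sq
    have hB : ∀ s ∈ Ico 0 t, HasDerivWithinAt (fun s => r ^ 2 + ε * s) ε (Ici s) s := by
      intro s _
      simpa using (((hasDerivAt_id s).const_mul ε).const_add (r ^ 2)).hasDerivWithinAt
    have hcont : ContinuousOn (fun s => ‖x s‖ ^ 2) (Icc 0 t) :=
      (hx.continuousOn.mono Icc_subset_Ici_self).norm.pow 2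
    refine image_le_of_deriv_right_lt_deriv_boundary' (a := 0) (b := t) hcont hder ?_ (by fun_prop) hB ?_
      ⟨ht, le_rfl⟩
    · rw [hx.1, mul_zero, add_zero]
      exact pow_le_pow_left₀ (norm_nonneg _) hv 2
    · intro s hs hs'
      have h1 : r ^ 2 ≤ ‖x s‖ ^ 2 := by
        have := mul_nonneg hε.le hs.1
        linarith
      have h2 := hF (x s) (le_of_sq_le_sq h1 (norm_nonneg _))
      rw [real_inner_comm] at h2
      linarith
  refine le_of_sq_le_sq (le_of_forall_pos_le_add fun ε hε => ?_) hr
  refine (key (ε / (t + 1)) (by positivity)).trans ?_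
  have : ε / (t + 1) * t ≤ ε := by
    rw [div_mul_eq_mul_div, div_le_iff₀ (by positivity)]
    nlinarith
  linarith

/-- Grönwall's estimate for two forward solutions in a set on which `F` is Lipschitz. -/
lemma IsForwardSolution.dist_le {K : ℝ≥0} {s : Set (Vec d)} (hF : LipschitzOnWith K F s)
    (hx : IsForwardSolution F u x) (hy : IsForwardSolution F v y)
    (hxs : ∀ t, 0 ≤ t → x t ∈ s) (hys : ∀ t, 0 ≤ t → y t ∈ s) {t : ℝ} (ht : 0 ≤ t) :
    dist (x t) (y t) ≤ dist u v * Real.exp (K * t) := by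
  have := dist_le_of_trajectories_ODE_of_mem (v := fun _ => F) (s := fun _ => s) (a := 0) (b := t)
    (K := K) (δ := dist u v) (fun _ _ => hF)
    (hx.continuousOn.mono Icc_subset_Ici_self) (fun τ hτ => hx.hasDerivWithinAt_Ici hτ.1)
    (fun τ hτ => hxs τ hτ.1)
    (hy.continuousOn.mono Icc_subset_Ici_self) (fun τ hτ => hy.hasDerivWithinAt_Ici hτ.1)
    (fun τ hτ => hys τ hτ.1) (by rw [hx.1, hy.1]) t ⟨ht, le_rfl⟩
  simpa using this

/-- Two forward solutions which meet at some time start from the same point. -/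
lemma IsForwardSolution.eq_of_eq {K : ℝ≥0} {s : Set (Vec d)} (hF : LipschitzOnWith K F s)
    (hx : IsForwardSolution F u x) (hy : IsForwardSolution F v y)
    (hxs : ∀ t, 0 ≤ t → x t ∈ s) (hys : ∀ t, 0 ≤ t → y t ∈ s) {t : ℝ} (ht : 0 ≤ t)
    (h : x t = y t) : u = v := by
  have := ODE_solution_unique_of_mem_Icc_left (v := fun _ => F) (s := fun _ => s) (a := 0) (b := t)
    (K := K) (fun _ _ => hF)
    (hx.continuousOn.mono Icc_subset_Ici_self) (fun τ hτ => (hx.hasDerivAt hτ.1).hasDerivWithinAt)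
    (fun τ hτ => hxs τ hτ.1.le)
    (hy.continuousOn.mono Icc_subset_Ici_self) (fun τ hτ => (hy.hasDerivAt hτ.1).hasDerivWithinAt)
    (fun τ hτ => hys τ hτ.1.le) h ⟨le_rfl, ht⟩
  rwa [hx.1, hy.1] at this

lemma IsForwardSolution.shift (hx : IsForwardSolution F v x) {s : ℝ} (hs : 0 ≤ s) :
    IsForwardSolution F (x s) (fun t => x (s + t)) := by
  refine ⟨by simp, fun t ht => ?_⟩
  have h1 := hx.2 (s + t) (add_nonneg hs ht)
  have h2 : HasDerivWithinAt (fun t : ℝ => s + t) 1 (Ici 0) t :=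
    ((hasDerivAt_id t).const_add s).hasDerivWithinAt
  simpa [Function.comp_def] using
    HasDerivWithinAt.scomp t h1 h2 fun τ hτ => add_nonneg hs (mem_Ici.1 hτ)

lemma IsForwardSolution.congr_field {G : Vec d → Vec d} (hx : IsForwardSolution F v x)
    (h : ∀ t, 0 ≤ t → G (x t) = F (x t)) : IsForwardSolution G v x :=
  ⟨hx.1, fun t ht => by rw [h t ht]; exact hx.2 t ht⟩

/-- A bounded Lipschitz vector field has forward solutions. -/
lemma exists_isForwardSolution_of_bounded {K : ℝ≥0} (hF : LipschitzWith K F) {L : ℝ≥0}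
    (hL : ∀ w, ‖F w‖ ≤ L) (v : Vec d) : ∃ x, IsForwardSolution F v x := by
  have ex : ∀ a : ℝ, 0 ≤ a → ∃ α : ℝ → Vec d, α 0 = v ∧
      ∀ t ∈ Icc 0 a, HasDerivWithinAt α (F (α t)) (Icc 0 a) t := by
    intro a ha
    -- A solution of speed at most `L` stays within distance `L * a` up to time `a`, so
    -- Picard–Lindelöf applies on an interval of any length.
    have hPL : IsPicardLindelof (fun _ => F) (tmin := 0) (tmax := a) ⟨0, le_rfl, ha⟩ v
        (L * a.toNNReal) 0 L K :=
      { lipschitzOnWith := fun _ _ => hF.lipschitzOnWith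
        continuousOn := fun _ _ => continuousOn_const
        norm_le := fun _ _ w _ => hL w
        mul_max_le := by simp [ha] }
    exact hPL.exists_eq_forall_mem_Icc_hasDerivWithinAt₀
  choose! α hα0 hα using ex
  have eq : ∀ a b : ℝ, 0 ≤ a → a ≤ b → EqOn (α a) (α b) (Icc 0 a) := by
    intro a b ha hab
    have aux : ∀ c, a ≤ c → ContinuousOn (α c) (Icc 0 a) ∧
        ∀ t ∈ Ico 0 a, HasDerivWithinAt (α c) (F (α c t)) (Ici t) t := by
      intro c hc
      refine ⟨fun t ht => ((hα c (ha.trans hc) t ⟨ht.1, ht.2.trans hc⟩).continuousWithinAt).mono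
        (Icc_subset_Icc_right hc), fun t ht => ?_⟩
      refine (hα c (ha.trans hc) t ⟨ht.1, ht.2.le.trans hc⟩).mono_of_mem_nhdsWithin ?_
      exact mem_of_superset (Icc_mem_nhdsGE (ht.2.trans_le hc)) (Icc_subset_Icc_left ht.1)
    exact ODE_solution_unique (v := fun _ => F) (fun _ => hF) (aux a le_rfl).1 (aux a le_rfl).2
      (aux b hab).1 (aux b hab).2 (by rw [hα0 a ha, hα0 b (ha.trans hab)])
  -- The horizon `t + 1` lies strictly beyond `t`, so around each `t` the glued curve coincides with
  -- the single solution `α (t + 2)`.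
  refine ⟨fun t => α (t + 1) t, hα0 _ (by norm_num), fun t ht => ?_⟩
  have h1 : HasDerivWithinAt (α (t + 2)) (F (α (t + 2) t)) (Ici 0) t := by
    refine (hα (t + 2) (by linarith) t ⟨ht, by linarith⟩).mono_of_mem_nhdsWithin ?_
    filter_upwards [self_mem_nhdsWithin, mem_nhdsWithin_of_mem_nhds
      (Iic_mem_nhds (show t < t + 2 by linarith))] with s hs1 hs2 using ⟨hs1, hs2⟩
  have h2 : ∀ s, 0 ≤ s → s ≤ t + 1 → α (s + 1) s = α (t + 2) s := fun s hs hst =>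
    eq (s + 1) (t + 2) (by linarith) (by linarith) ⟨hs, by linarith⟩
  beta_reduce
  rw [h2 t ht (by linarith)]
  refine h1.congr_of_eventuallyEq ?_ (h2 t ht (by linarith))
  filter_upwards [self_mem_nhdsWithin, mem_nhdsWithin_of_mem_nhds
    (Iic_mem_nhds (show t < t + 1 by linarith))] with s hs1 hs2 using h2 s hs1 hs2

/-- A smooth vector field that does not point outwards outside of a ball has forward solutions. -/
lemma exists_isForwardSolution (hF : ContDiff ℝ 1 F) {M : ℝ}
    (hM : ∀ w, M ≤ ‖w‖ → ⟪F w, w⟫_ℝ ≤ 0) (v : Vec d) : ∃ x, IsForwardSolution F v x := by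
  set ρ : ℝ := max 1 (max M ‖v‖)
  have hρ : 0 < ρ := lt_of_lt_of_le one_pos (le_max_left _ _)
  -- The truncated field is bounded and still does not point outwards beyond radius `ρ`. Its
  -- solution stays where `χ = 1`, and so solves the original equation.
  let χ : ContDiffBump (0 : Vec d) := ⟨ρ, ρ + 1, hρ, by linarith⟩
  let G : Vec d → Vec d := fun w => χ w • F w
  have hG : ContDiff ℝ 1 G := χ.contDiff.smul hF
  have hGc : HasCompactSupport G := χ.hasCompactSupport.smul_right
  obtain ⟨K, hK⟩ := ContDiff.lipschitzWith_of_hasCompactSupport hGc hG one_ne_zero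
  obtain ⟨L, hL⟩ := hGc.exists_bound_of_continuous hG.continuous
  obtain ⟨x, hx⟩ := exists_isForwardSolution_of_bounded hK (L := L.toNNReal)
    (fun w => (hL w).trans (Real.le_coe_toNNReal L)) v
  refine ⟨x, hx.congr_field fun t ht => ?_⟩
  have hxt : ‖x t‖ ≤ ρ := by
    refine hx.norm_le (fun w hw => ?_) ((le_max_right M _).trans (le_max_right 1 _)) ht
    rw [real_inner_smul_left]
    exact mul_nonpos_of_nonneg_of_nonpos χ.nonneg
      (hM w (((le_max_left M _).trans (le_max_right 1 _)).trans hw))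
  have : χ (x t) = 1 := χ.one_of_mem_closedBall (by simpa using hxt)
  simp [G, this]

end ForwardSolution

/-! ### The flow of a dissipative vector field -/

/-- The vector field `F` is smooth and does not point outwards outside of the ball of
radius `M`. -/
structure Dissipative {d : ℕ} (F : Vec d → Vec d) (M : ℝ) : Prop where
  contDiff : ContDiff ℝ (⊤ : ℕ∞) F
  inner_nonpos : ∀ w, M ≤ ‖w‖ → ⟪F w, w⟫_ℝ ≤ 0

section Flow

variable {d : ℕ} {F : Vec d → Vec d} {M R : ℝ}

lemma Dissipative.mono (hF : Dissipative F M) (h : M ≤ R) : Dissipative F R :=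
  ⟨hF.contDiff, fun w hw => hF.inner_nonpos w (h.trans hw)⟩

lemma Dissipative.isForwardSolution_flow (hF : Dissipative F M) (v : Vec d) :
    IsForwardSolution F v (fun t => flow F t v) :=
  Classical.epsilon_spec (exists_isForwardSolution (hF.contDiff.of_le (by simp))
    hF.inner_nonpos v)

lemma isCompact_ballR : IsCompact (ballR d R) := by
  convert! isCompact_closedBall (0 : Vec d) R using 1
  ext; simp [ballR]

lemma convex_ballR : Convex ℝ (ballR d R) := by
  convert! convex_closedBall (0 : Vec d) R using 1
  ext; simp [ballR]

lemma exists_lipschitzOnWith_ballR {E : Type*} [NormedAddCommGroup E] [NormedSpace ℝ E]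
    {g : Vec d → E} (hg : ContDiff ℝ (⊤ : ℕ∞) g) : ∃ K, LipschitzOnWith K g (ballR d R) :=
  (hg.of_le (m := 1) (by simp)).contDiffOn.exists_lipschitzOnWith one_ne_zero convex_ballR
    isCompact_ballR

lemma Dissipative.flow_mem (hF : Dissipative F R) {v : Vec d} (hv : v ∈ ballR d R) {t : ℝ}
    (ht : 0 ≤ t) : flow F t v ∈ ballR d R :=
  (hF.isForwardSolution_flow v).norm_le hF.inner_nonpos hv ht

lemma Dissipative.flow_zero (hF : Dissipative F M) (v : Vec d) : flow F 0 v = v :=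
  (hF.isForwardSolution_flow v).1

lemma Dissipative.exists_norm_flow_sub_le (hF : Dissipative F R) :
    ∃ K : ℝ≥0, ∀ u ∈ ballR d R, ∀ v ∈ ballR d R, ∀ t, 0 ≤ t →
      ‖flow F t u - flow F t v‖ ≤ ‖u - v‖ * Real.exp (K * t) := by
  obtain ⟨K, hK⟩ := exists_lipschitzOnWith_ballR (R := R) hF.contDiff
  refine ⟨K, fun u hu v hv t ht => ?_⟩
  simpa [dist_eq_norm] using IsForwardSolution.dist_le hK (hF.isForwardSolution_flow u)
    (hF.isForwardSolution_flow v) (fun t ht => hF.flow_mem hu ht)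
    (fun t ht => hF.flow_mem hv ht) ht

lemma Dissipative.injOn_flow (hF : Dissipative F R) {t : ℝ} (ht : 0 ≤ t) :
    InjOn (flow F t) (ballR d R) := by
  intro u hu v hv h
  obtain ⟨K, hK⟩ := exists_lipschitzOnWith_ballR (R := R) hF.contDiff
  exact IsForwardSolution.eq_of_eq hK (hF.isForwardSolution_flow u)
    (hF.isForwardSolution_flow v) (fun t ht => hF.flow_mem hu ht)
    (fun t ht => hF.flow_mem hv ht) ht h

lemma Dissipative.continuousOn_flow (hF : Dissipative F R) {t : ℝ} (ht : 0 ≤ t) :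
    ContinuousOn (flow F t) (ballR d R) := by
  obtain ⟨K, hK⟩ := hF.exists_norm_flow_sub_le
  refine (LipschitzOnWith.of_dist_le_mul (K := (Real.exp (K * t)).toNNReal)
    fun u hu v hv => ?_).continuousOn
  rw [dist_eq_norm, dist_eq_norm, Real.coe_toNNReal _ (Real.exp_pos _).le, mul_comm]
  exact hK u hu v hv t ht

lemma Dissipative.flow_add (hF : Dissipative F R) {v : Vec d} (hv : v ∈ ballR d R) {s t : ℝ}
    (hs : 0 ≤ s) (ht : 0 ≤ t) : flow F (s + t) v = flow F t (flow F s v) := by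
  obtain ⟨K, hK⟩ := exists_lipschitzOnWith_ballR (R := R) hF.contDiff
  have := IsForwardSolution.dist_le hK ((hF.isForwardSolution_flow v).shift hs)
    (hF.isForwardSolution_flow (flow F s v))
    (fun t ht => hF.flow_mem hv (add_nonneg hs ht))
    (fun t ht => hF.flow_mem (hF.flow_mem hv hs) ht) ht
  simpa using this

lemma Dissipative.flowInv_flow (hF : Dissipative F R) {v : Vec d} (hv : v ∈ ballR d R) {t : ℝ}
    (ht : 0 ≤ t) : flowInv F R t (flow F t v) = v :=
  (hF.injOn_flow ht).leftInvOn_invFunOn hv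

end Flow

/-! ### Lie derivatives and time derivatives -/

/-- The derivative of `g` along the vector field `F`. -/
noncomputable def lieDeriv {d : ℕ} (F : Vec d → Vec d) (g : Vec d → ℝ) (v : Vec d) : ℝ :=
  fderiv ℝ g v (F v)

/-- The `c`-th coordinate function. -/
def coord {d : ℕ} (c : Fin d) (v : Vec d) : ℝ := v c

section LieDeriv

variable {d : ℕ} {F : Vec d → Vec d} {M R : ℝ} {f g : Vec d → ℝ}

lemma contDiff_coord (c : Fin d) : ContDiff ℝ (⊤ : ℕ∞) (coord c) :=
  (EuclideanSpace.proj (𝕜 := ℝ) c).contDiff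

lemma contDiff_lieDeriv (hF : ContDiff ℝ (⊤ : ℕ∞) F) (hg : ContDiff ℝ (⊤ : ℕ∞) g) :
    ContDiff ℝ (⊤ : ℕ∞) (lieDeriv F g) :=
  (hg.fderiv_right (m := (⊤ : ℕ∞)) (by simp)).clm_apply hF

lemma contDiff_iterate_lieDeriv (hF : ContDiff ℝ (⊤ : ℕ∞) F) (hg : ContDiff ℝ (⊤ : ℕ∞) g) (n : ℕ) :
    ContDiff ℝ (⊤ : ℕ∞) ((lieDeriv F)^[n] g) := by
  induction n generalizing g with
  | zero => exact hg
  | succ n ih => exact ih (contDiff_lieDeriv hF hg)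

lemma differentiableAt_of_contDiff (hg : ContDiff ℝ (⊤ : ℕ∞) g) (v : Vec d) :
    DifferentiableAt ℝ g v := (hg.differentiable (by simp)) v

lemma lieDeriv_coord (c : Fin d) : lieDeriv F (coord c) = fun v => F v c := by
  funext v
  change fderiv ℝ (EuclideanSpace.proj (𝕜 := ℝ) c) v (F v) = _
  rw [ContinuousLinearMap.fderiv]
  rfl

lemma lieDeriv_const (a : ℝ) : lieDeriv F (fun _ => a) = fun _ => 0 := by
  funext v
  simp [lieDeriv]

lemma lieDeriv_add (hf : ContDiff ℝ (⊤ : ℕ∞) f) (hg : ContDiff ℝ (⊤ : ℕ∞) g) :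
    lieDeriv F (f + g) = lieDeriv F f + lieDeriv F g := by
  funext v
  simp [lieDeriv, fderiv_add (differentiableAt_of_contDiff hf v) (differentiableAt_of_contDiff hg v)]

lemma lieDeriv_mul (hf : ContDiff ℝ (⊤ : ℕ∞) f) (hg : ContDiff ℝ (⊤ : ℕ∞) g) :
    lieDeriv F (f * g) = f * lieDeriv F g + lieDeriv F f * g := by
  funext v
  simp [lieDeriv, fderiv_mul (differentiableAt_of_contDiff hf v) (differentiableAt_of_contDiff hg v),
    mul_comm]

lemma Dissipative.hasDerivWithinAt_comp_flow (hF : Dissipative F M) (hg : ContDiff ℝ (⊤ : ℕ∞) g)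
    (v : Vec d) {t : ℝ} (ht : 0 ≤ t) :
    HasDerivWithinAt (fun t => g (flow F t v)) (lieDeriv F g (flow F t v)) (Ici 0) t :=
  (differentiableAt_of_contDiff hg _).hasFDerivAt.comp_hasDerivWithinAt t
    ((hF.isForwardSolution_flow v).2 t ht)

end LieDeriv

/-! ### Higher one-sided derivatives and Taylor expansion. -/

section IteratedDeriv

variable {E : Type*} [NormedAddCommGroup E] [NormedSpace ℝ E] {f : ℕ → ℝ → E} {s : Set ℝ}

lemma iteratedDerivWithin_eqOn_of_hasDerivWithinAt (hs : UniqueDiffOn ℝ s)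
    (hf : ∀ n, ∀ t ∈ s, HasDerivWithinAt (f n) (f (n + 1) t) s t) (n : ℕ) :
    EqOn (iteratedDerivWithin n (f 0) s) (f n) s := by
  induction n with
  | zero => intro t _; simp
  | succ n ih =>
    intro t ht
    rw [iteratedDerivWithin_succ, derivWithin_congr ih (ih ht)]
    exact (hf n t ht).derivWithin (hs t ht)

/-- Taylor's formula for a sequence of functions, each the derivative of the previous one. -/
lemma norm_sub_sum_le_of_hasDerivWithinAt
    (hf : ∀ n, ∀ t, 0 ≤ t → HasDerivWithinAt (f n) (f (n + 1) t) (Ici 0) t) {n : ℕ} {b C : ℝ}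
    (hC : ∀ t, 0 ≤ t → t ≤ b → ‖f (n + 1) t‖ ≤ C) {t : ℝ} (ht : 0 ≤ t) (htb : t ≤ b) :
    ‖f 0 t - ∑ m ∈ Finset.range (n + 1), ((m.factorial : ℝ)⁻¹ * t ^ m) • f m 0‖ ≤
      C * t ^ (n + 1) / n.factorial := by
  -- When `t = 0` the interval `[0, b]` may be a single point, where derivatives within it are not
  -- unique.
  rcases ht.eq_or_lt with rfl | ht0
  · simp [Finset.sum_range_succ']
  have hb : 0 < b := ht0.trans_le htb
  have hu : UniqueDiffOn ℝ (Icc 0 b) := uniqueDiffOn_Icc hb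
  have hf' : ∀ n, ∀ t ∈ Icc 0 b, HasDerivWithinAt (f n) (f (n + 1) t) (Icc 0 b) t :=
    fun n t ht => (hf n t ht.1).mono Icc_subset_Ici_self
  have hit := fun n => iteratedDerivWithin_eqOn_of_hasDerivWithinAt hu hf' n
  have hcd : ContDiffOn ℝ ((n + 1 : ℕ) : ℕ∞) (f 0) (Icc 0 b) := by
    refine contDiffOn_of_differentiableOn_deriv fun m _ t ht => ?_
    exact ((hf' m t ht).differentiableWithinAt).congr (fun s hs => hit m hs) (hit m ht)
  have := taylor_mean_remainder_bound (n := n) (C := C) (x := t) hb.le (by exact_mod_cast hcd)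
    ⟨ht, htb⟩ (fun y hy => by rw [hit (n + 1) hy]; exact hC y hy.1 hy.2)
  rw [taylor_within_apply] at this
  simp only [sub_zero] at this
  convert this using 5 with m _
  exact (hit _ ⟨le_rfl, hb.le⟩).symm

end IteratedDeriv

section TimeDeriv

variable {d : ℕ} {F : Vec d → Vec d} {M R : ℝ}

/-- Differentiating `g` along a trajectory amounts to replacing `g` by its Lie derivative. Iteration
turns time derivatives into smooth functions of the initial point. -/
lemma Dissipative.timeDeriv_apply (hF : Dissipative F M) (n : ℕ) (v : Vec d) (c : Fin d) :
    timeDeriv F n v c = (lieDeriv F)^[n] (coord c) v := by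
  let f : ℕ → ℝ → Vec d := fun n t =>
    WithLp.toLp 2 fun c => (lieDeriv F)^[n] (coord c) (flow F t v)
  have hf : ∀ n, ∀ t ∈ Ici (0 : ℝ), HasDerivWithinAt (f n) (f (n + 1) t) (Ici 0) t := by
    intro n t ht
    rw [hasDerivWithinAt_iff_hasFDerivWithinAt, hasFDerivWithinAt_euclidean]
    intro c
    rw [hasFDerivWithinAt_iff_hasDerivWithinAt]
    have := hF.hasDerivWithinAt_comp_flow
      (contDiff_iterate_lieDeriv hF.contDiff (contDiff_coord c) n) v (mem_Ici.1 ht)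
    convert! this using 1
    simp [f, Function.iterate_succ_apply', -Function.iterate_succ]
  have h0 : f 0 = fun t => flow F t v := rfl
  have := iteratedDerivWithin_eqOn_of_hasDerivWithinAt (uniqueDiffOn_Ici 0) hf n
    (mem_Ici.2 (le_refl (0 : ℝ)))
  rw [h0] at this
  rw [timeDeriv, this]
  simp [f, hF.flow_zero]

end TimeDeriv

/-! ### Functions whose derivatives along the flow are controlled -/

/-- The derivatives of `g` along `F` of order at most `n` vary, around `u` and in the ball, by at
most a multiple of `S`. -/
structure Controlled {d : ℕ} (F : Vec d → Vec d) (R : ℝ) (u : Vec d) (S : Vec d → ℝ) (n : ℕ)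
    (g : Vec d → ℝ) : Prop where
  contDiff : ContDiff ℝ (⊤ : ℕ∞) g
  exists_le : ∀ i ≤ n, ∃ C, ∀ v ∈ ballR d R,
    |(lieDeriv F)^[i] g v - (lieDeriv F)^[i] g u| ≤ C * S v

section Controlled

variable {d : ℕ} {F : Vec d → Vec d} {R : ℝ} {u : Vec d} {S : Vec d → ℝ} {n : ℕ}
  {f g : Vec d → ℝ}

lemma Controlled.mono (hg : Controlled F R u S n g) {m : ℕ} (h : m ≤ n) :
    Controlled F R u S m g := ⟨hg.1, fun i hi => hg.2 i (hi.trans h)⟩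

lemma Controlled.lieDeriv (hF : ContDiff ℝ (⊤ : ℕ∞) F) (hg : Controlled F R u S (n + 1) g) :
    Controlled F R u S n (lieDeriv F g) :=
  ⟨contDiff_lieDeriv hF hg.1, fun i hi => hg.2 (i + 1) (Nat.succ_le_succ hi)⟩

/-- Peels off one derivative; this is what lets the closure properties below be proved by induction
on the order. -/
lemma Controlled.succ (h0 : Controlled F R u S 0 g)
    (hg : Controlled F R u S n (ObservedODE.lieDeriv F g)) : Controlled F R u S (n + 1) g := by
  refine ⟨h0.1, fun i hi => ?_⟩
  cases i with
  | zero => exact h0.2 0 le_rfl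
  | succ i => exact hg.2 i (Nat.le_of_succ_le_succ hi)

lemma controlled_zero_iff : Controlled F R u S 0 g ↔ ContDiff ℝ (⊤ : ℕ∞) g ∧
    ∃ C, ∀ v ∈ ballR d R, |g v - g u| ≤ C * S v :=
  ⟨fun h => ⟨h.1, h.2 0 le_rfl⟩, fun h => ⟨h.1, fun i hi => by
    obtain rfl := Nat.le_zero.1 hi; exact h.2⟩⟩

lemma controlled_const (a : ℝ) : Controlled F R u S n (fun _ => a) := by
  induction n generalizing a with
  | zero => exact controlled_zero_iff.2 ⟨contDiff_const, 0, by simp⟩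
  | succ n ih =>
    refine Controlled.succ ((ih a).mono (Nat.zero_le n)) ?_
    rw [lieDeriv_const]
    exact ih 0

lemma Controlled.add (hF : ContDiff ℝ (⊤ : ℕ∞) F) (hf : Controlled F R u S n f)
    (hg : Controlled F R u S n g) : Controlled F R u S n (f + g) := by
  induction n generalizing f g with
  | zero =>
    obtain ⟨C, hC⟩ := (controlled_zero_iff.1 hf).2
    obtain ⟨D, hD⟩ := (controlled_zero_iff.1 hg).2
    refine controlled_zero_iff.2 ⟨hf.1.add hg.1, C + D, fun v hv => ?_⟩
    calc |(f + g) v - (f + g) u| = |(f v - f u) + (g v - g u)| := by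
          simp only [Pi.add_apply]; ring_nf
      _ ≤ |f v - f u| + |g v - g u| := abs_add_le _ _
      _ ≤ (C + D) * S v := by linarith [hC v hv, hD v hv]
  | succ n ih =>
    refine Controlled.succ (ih (hf.mono n.le_succ) (hg.mono n.le_succ) |>.mono n.zero_le) ?_
    rw [lieDeriv_add hf.1 hg.1]
    exact ih (hf.lieDeriv hF) (hg.lieDeriv hF)

lemma exists_abs_le_ballR (hg : ContDiff ℝ (⊤ : ℕ∞) g) :
    ∃ C, ∀ v ∈ ballR d R, |g v| ≤ C :=
  isCompact_ballR.exists_bound_of_continuousOn hg.continuous.continuousOn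

lemma Controlled.mul (hF : ContDiff ℝ (⊤ : ℕ∞) F) (hf : Controlled F R u S n f)
    (hg : Controlled F R u S n g) : Controlled F R u S n (f * g) := by
  induction n generalizing f g with
  | zero =>
    obtain ⟨C, hC⟩ := (controlled_zero_iff.1 hf).2
    obtain ⟨D, hD⟩ := (controlled_zero_iff.1 hg).2
    obtain ⟨B, hB⟩ := exists_abs_le_ballR (R := R) hf.1
    refine controlled_zero_iff.2 ⟨hf.1.mul hg.1, B * D + |g u| * C, fun v hv => ?_⟩
    calc |(f * g) v - (f * g) u| = |f v * (g v - g u) + g u * (f v - f u)| := by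
          simp only [Pi.mul_apply]; ring_nf
      _ ≤ |f v| * |g v - g u| + |g u| * |f v - f u| := by
          rw [← abs_mul, ← abs_mul]; exact abs_add_le _ _
      _ ≤ B * (D * S v) + |g u| * (C * S v) := by
          gcongr
          · exact (abs_nonneg _).trans (hB v hv)
          · exact hB v hv
          · exact hD v hv
          · exact hC v hv
      _ = (B * D + |g u| * C) * S v := by ring
  | succ n ih =>
    refine Controlled.succ (ih (hf.mono n.le_succ) (hg.mono n.le_succ) |>.mono n.zero_le) ?_
    rw [lieDeriv_mul hf.1 hg.1]
    exact (ih (hf.mono n.le_succ) (hg.lieDeriv hF)).add hF (ih (hf.lieDeriv hF) (hg.mono n.le_succ))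

lemma Controlled.neg (hF : ContDiff ℝ (⊤ : ℕ∞) F) (hf : Controlled F R u S n f) :
    Controlled F R u S n (-f) := by
  have : -f = (fun _ => -1) * f := by funext v; simp
  rw [this]
  exact (controlled_const _).mul hF hf

/-- Division by a controlled function that does not vanish at `u`. -/
lemma Controlled.of_mul (hF : ContDiff ℝ (⊤ : ℕ∞) F) (hf : Controlled F R u S n f)
    (hfg : Controlled F R u S n (f * g)) (hg : ContDiff ℝ (⊤ : ℕ∞) g) (hu : f u ≠ 0) :
    Controlled F R u S n g := by
  induction n generalizing g with
  | zero =>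
    obtain ⟨C, hC⟩ := (controlled_zero_iff.1 hf).2
    obtain ⟨D, hD⟩ := (controlled_zero_iff.1 hfg).2
    obtain ⟨B, hB⟩ := exists_abs_le_ballR (R := R) hg
    refine controlled_zero_iff.2 ⟨hg, (D + B * C) / |f u|, fun v hv => ?_⟩
    have hu' : 0 < |f u| := abs_pos.2 hu
    rw [div_mul_eq_mul_div, le_div_iff₀ hu', mul_comm, ← abs_mul]
    calc |f u * (g v - g u)| = |((f * g) v - (f * g) u) + -(g v * (f v - f u))| := by
          simp only [Pi.mul_apply]; ring_nf
      _ ≤ |(f * g) v - (f * g) u| + |g v| * |f v - f u| := by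
          rw [← abs_mul, ← abs_neg (g v * (f v - f u))]; exact abs_add_le _ _
      _ ≤ D * S v + B * (C * S v) := by
          gcongr
          · exact hD v hv
          · exact (abs_nonneg _).trans (hB v hv)
          · exact hB v hv
          · exact hC v hv
      _ = (D + B * C) * S v := by ring
  | succ n ih =>
    have h1 : Controlled F R u S n g := ih (hf.mono n.le_succ) (hfg.mono n.le_succ) hg
    refine Controlled.succ (h1.mono n.zero_le) ?_
    refine ih (hf.mono n.le_succ) ?_ (contDiff_lieDeriv hF hg)
    -- By Leibniz, the derivative of the quotient is again a quotient with denominator `f`, one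
    -- order lower, so the induction hypothesis applies to it.
    have : f * ObservedODE.lieDeriv F g
        = ObservedODE.lieDeriv F (f * g) + -(ObservedODE.lieDeriv F f * g) := by
      rw [lieDeriv_mul hf.1 hg]; ring
    rw [this]
    exact (hfg.lieDeriv hF).add hF (((hf.lieDeriv hF).mul hF h1).neg hF)

end Controlled

/-! ### The Lorenz 96 vector field -/

lemma abs_sum_le {d : ℕ} (v : Vec d) : |∑ i, v i| ≤ √d * ‖v‖ := by
  rw [EuclideanSpace.norm_eq, ← Real.sqrt_mul (by positivity)]
  refine Real.abs_le_sqrt ?_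
  simpa using sq_sum_le_card_mul_sum_sq (s := Finset.univ) (f := fun i => v i)

section Lorenz

variable {d : ℕ} [NeZero d]

lemma lorenz96_apply (v : Vec d) (i : Fin d) :
    lorenz96 d v i = v (i - 1) * (v (i + 1) - v (i - 2)) - v i + 8 := by
  simp only [lorenz96, lorenzA, lorenzB, lorenzForcing, PiLp.add_apply, PiLp.sub_apply,
    PiLp.neg_apply, LinearMap.id_apply]
  ring

lemma contDiff_lorenz96 : ContDiff ℝ (⊤ : ℕ∞) (lorenz96 d) := by
  rw [contDiff_euclidean]
  intro i
  simp only [lorenz96_apply]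
  have h := fun c : Fin d => contDiff_coord c
  exact (((h _).mul ((h _).sub (h _))).sub (h _)).add contDiff_const

lemma fin_val_one (hd : 3 ≤ d) : ((1 : Fin d) : ℕ) = 1 :=
  Nat.mod_eq_of_lt (show 1 < d by omega)

lemma fin_val_two (hd : 3 ≤ d) : ((2 : Fin d) : ℕ) = 2 :=
  Nat.mod_eq_of_lt (show 2 < d by omega)

/-- The quadratic part of the field conserves energy: its two cubic sums are cyclic shifts of each
other. -/
lemma inner_lorenz96 (hd : 3 ≤ d) (v : Vec d) :
    ⟪lorenz96 d v, v⟫_ℝ = 8 * ∑ i, v i - ‖v‖ ^ 2 := by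
  have h2 : (1 : Fin d) + 1 = 2 := by
    ext
    rw [Fin.val_add, fin_val_one hd, fin_val_two hd, Nat.mod_eq_of_lt (by omega)]
  have hshift : ∑ i : Fin d, v i * v (i - 1) * v (i - 2) = ∑ i : Fin d, v (i + 1) * v i * v (i - 1) := by
    rw [← Equiv.sum_comp (Equiv.subRight (1 : Fin d)) fun i => v (i + 1) * v i * v (i - 1)]
    refine Finset.sum_congr rfl fun i _ => ?_
    simp only [Equiv.subRight_apply, sub_add_cancel, sub_sub, h2]
  rw [PiLp.inner_apply, EuclideanSpace.norm_sq_eq, Finset.mul_sum]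
  have : ∑ i, ⟪lorenz96 d v i, v i⟫_ℝ = ∑ i, v (i + 1) * v i * v (i - 1)
      - ∑ i, v i * v (i - 1) * v (i - 2) + (∑ i, 8 * v i - ∑ i, ‖v i‖ ^ 2) := by
    rw [← Finset.sum_sub_distrib, ← Finset.sum_sub_distrib, ← Finset.sum_add_distrib]
    refine Finset.sum_congr rfl fun i _ => ?_
    rw [lorenz96_apply, Real.norm_eq_abs, sq_abs]
    simp only [RCLike.inner_apply, conj_trivial]
    ring
  rw [this, hshift]
  ring

lemma dissipative_lorenz96 (hd : 3 ≤ d) : Dissipative (lorenz96 d) (8 * √d) := by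
  refine ⟨contDiff_lorenz96, fun w hw => ?_⟩
  rw [inner_lorenz96 hd]
  have := (abs_le.1 (abs_sum_le w)).2
  nlinarith [norm_nonneg w]

/-- Tested on the constant vector of norm `R`, which maximises `∑ v i` on the sphere, the trapping
assumption forces `R ≥ 8 * √d`. The field then does not point outwards anywhere beyond the ball, not
only in the shell. -/
lemma TrappingBall.dissipative (hd : 3 ≤ d) {R : ℝ} (hR : TrappingBall (lorenz96 d) R) :
    Dissipative (lorenz96 d) R := by
  refine (dissipative_lorenz96 hd).mono ?_
  obtain ⟨hR0, δ, hδ, h⟩ := hR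
  have hd0 : 0 < √(d : ℝ) := by positivity
  have hs : √(d : ℝ) ^ 2 = d := Real.sq_sqrt (by positivity)
  let v : Vec d := WithLp.toLp 2 fun _ => R / √d
  have hv : ‖v‖ = R := by
    rw [EuclideanSpace.norm_eq]
    simp only [v, Finset.sum_const, Finset.card_univ, Fintype.card_fin, nsmul_eq_mul]
    rw [Real.norm_of_nonneg (by positivity), div_pow, hs, mul_div_cancel₀ _ (by positivity),
      Real.sqrt_sq hR0.le]
  have h1 := h v hv.ge (by linarith)
  rw [inner_lorenz96 hd, hv] at h1
  simp only [v, Finset.sum_const, Finset.card_univ, Fintype.card_fin, nsmul_eq_mul] at h1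
  have h2 : (d : ℝ) * (R / √d) = √d * R := by
    field_simp
    rw [hs]
  rw [h2] at h1
  nlinarith

/-- The equation for coordinate `m + 2`, solved for the term containing coordinate `m + 3`; since `m
+ 3 < d`, no index wraps around. -/
lemma lieDeriv_lorenz96_coord (hd : 3 ≤ d) (m : ℕ) (hm : m + 3 < d) :
    (coord ⟨m + 1, by omega⟩ : Vec d → ℝ) * coord ⟨m + 3, hm⟩ =
      lieDeriv (lorenz96 d) (coord ⟨m + 2, by omega⟩) + coord ⟨m + 2, by omega⟩
        + (fun _ => -8) + coord ⟨m + 1, by omega⟩ * coord ⟨m, by omega⟩ := by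
  have e1 : (⟨m + 2, by omega⟩ : Fin d) - 1 = ⟨m + 1, by omega⟩ := by
    rw [sub_eq_iff_eq_add]
    ext
    rw [Fin.val_add, fin_val_one hd, Nat.mod_eq_of_lt (by simp; omega)]
  have e2 : (⟨m + 2, by omega⟩ : Fin d) + 1 = ⟨m + 3, by omega⟩ := by
    ext
    rw [Fin.val_add, fin_val_one hd, Nat.mod_eq_of_lt (by simp; omega)]
  have e3 : (⟨m + 2, by omega⟩ : Fin d) - 2 = ⟨m, by omega⟩ := by
    rw [sub_eq_iff_eq_add]
    ext
    rw [Fin.val_add, fin_val_two hd, Nat.mod_eq_of_lt (by simp; omega)]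
  funext v
  simp only [lieDeriv_coord, Pi.mul_apply, Pi.add_apply, lorenz96_apply, e1, e2, e3, coord]
  ring

/-- The indices of the observed coordinates. -/
def observedIdx (d : ℕ) : Finset (Fin d) := Finset.univ.filter fun l => (l : ℕ) < 3

/-- Each step gains one coordinate and loses one order of control, the factor `u (m + 1) ≠ 0` being
divided out. -/
lemma controlled_coord {R : ℝ} {u : Vec d} (hd : 3 ≤ d) (hu : ∀ i, u i ≠ 0) {S : Vec d → ℝ}
    {j : ℕ} (h : ∀ l ∈ observedIdx d, Controlled (lorenz96 d) R u S j (coord l)) (m : ℕ)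
    (hm : m ≤ j) : ∀ c : Fin d, (c : ℕ) ≤ m + 2 → Controlled (lorenz96 d) R u S (j - m) (coord c) := by
  have hF := contDiff_lorenz96 (d := d)
  induction m with
  | zero =>
    intro c hc
    exact h c (by simp only [observedIdx, Finset.mem_filter, Finset.mem_univ, true_and]; omega)
  | succ m ih =>
    intro c hc
    have ih' := ih (by omega)
    rcases Nat.lt_or_ge c (m + 3) with hlt | hge
    · exact (ih' c (by omega)).mono (by omega)
    obtain ⟨c, hcd⟩ := c
    obtain rfl : c = m + 3 := le_antisymm hc hge
    have mon : ∀ l : Fin d, (l : ℕ) ≤ m + 2 → Controlled (lorenz96 d) R u S (j - (m + 1)) (coord l) :=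
      fun l hl => (ih' l hl).mono (by omega)
    refine Controlled.of_mul hF (f := coord ⟨m + 1, by omega⟩) (mon _ (by simp)) ?_
      (contDiff_coord _) (hu _)
    rw [lieDeriv_lorenz96_coord hd m hcd]
    -- Coordinate `m + 2` is the one that gets differentiated, so it is needed with one more order
    -- than the others.
    have h2 : Controlled (lorenz96 d) R u S (j - (m + 1) + 1) (coord ⟨m + 2, by omega⟩) := by
      rw [show j - (m + 1) + 1 = j - m by omega]
      exact ih' _ le_rfl
    exact (((h2.lieDeriv hF).add hF (mon _ le_rfl)).add hF (controlled_const _)).add hF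
      ((mon _ (by simp)).mul hF (mon _ (by simp)))

/-- The difference between the time derivatives of order at most `j` of the observed coordinates
at `v` and at `u`. -/
noncomputable def derivGap (d : ℕ) [NeZero d] (j : ℕ) (u v : Vec d) : ℝ :=
  ∑ i ∈ Finset.range (j + 1), ∑ l ∈ observedIdx d,
    |(lieDeriv (lorenz96 d))^[i] (coord l) v - (lieDeriv (lorenz96 d))^[i] (coord l) u|

/-- At a point without vanishing coordinate, the derivatives of the observed coordinates determine
the initial point in a Lipschitz way. -/
lemma exists_norm_sub_le_derivGap (hd : 3 ≤ d) (R : ℝ) {u : Vec d} (hu : ∀ i, u i ≠ 0) {j : ℕ}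
    (hj : d - 3 ≤ j) : ∃ C, 0 ≤ C ∧ ∀ v ∈ ballR d R, ‖v - u‖ ≤ C * derivGap d j u v := by
  have h : ∀ l ∈ observedIdx d,
      Controlled (lorenz96 d) R u (derivGap d j u) j (coord l) := by
    intro l hl
    refine ⟨contDiff_coord l, fun i hi => ⟨1, fun v _ => ?_⟩⟩
    rw [one_mul]
    refine le_trans ?_ (Finset.single_le_sum (fun i _ => Finset.sum_nonneg fun _ _ => abs_nonneg _)
      (Finset.mem_range.2 (Nat.lt_succ_of_le hi)))
    exact Finset.single_le_sum (f := fun l => |(lieDeriv (lorenz96 d))^[i] (coord l) v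
      - (lieDeriv (lorenz96 d))^[i] (coord l) u|) (fun _ _ => abs_nonneg _) hl
  -- After `d - 3` steps the last index `d - 1` is reached, and order `j - (d - 3) ≥ 0` of control
  -- remains.
  have h' : ∀ c : Fin d, ∃ C, ∀ v ∈ ballR d R, |v c - u c| ≤ C * derivGap d j u v := fun c =>
    (controlled_zero_iff.1 ((controlled_coord hd hu h (d - 3) hj c (by omega)).mono
      (Nat.zero_le _))).2
  choose C hC using h'
  have hS : ∀ v, 0 ≤ derivGap d j u v := fun v =>
    Finset.sum_nonneg fun _ _ => Finset.sum_nonneg fun _ _ => abs_nonneg _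
  refine ⟨∑ c, |C c|, Finset.sum_nonneg fun _ _ => abs_nonneg _, fun v hv => ?_⟩
  calc ‖v - u‖ ≤ ∑ c, |v c - u c| := by
        rw [EuclideanSpace.norm_eq]
        refine Real.sqrt_le_iff.2 ⟨Finset.sum_nonneg fun _ _ => abs_nonneg _, ?_⟩
        exact Finset.sum_sq_le_sq_sum_of_nonneg fun _ _ => abs_nonneg _
    _ ≤ ∑ c, |C c| * derivGap d j u v := Finset.sum_le_sum fun c _ =>
        (hC c v hv).trans (mul_le_mul_of_nonneg_right (le_abs_self _) (hS v))
    _ = _ := by rw [Finset.sum_mul]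

end Lorenz

/-! ### Observations of the first three coordinates -/

section Observe

variable {d p : ℕ}

lemma observe_firstThree_apply (v : Vec d) (k : Fin p) :
    observe (firstThree p d) v k = if h : (k : ℕ) < 3 ∧ (k : ℕ) < d then v ⟨k, h.2⟩ else 0 := by
  simp only [observe, firstThree, Matrix.mulVec, dotProduct, ite_mul, one_mul, zero_mul]
  split_ifs with h
  · rw [Finset.sum_eq_single ⟨k, h.2⟩]
    · simp [h.1]
    · intro b _ hb
      rw [if_neg]
      rintro ⟨h1, -⟩
      exact hb (Fin.ext h1.symm)
    · simp
  · refine Finset.sum_eq_zero fun b _ => if_neg ?_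
    rintro ⟨h1, h2⟩
    exact h ⟨h2, h1 ▸ b.2⟩

lemma observe_sub (H : Matrix (Fin p) (Fin d) ℝ) (v w : Vec d) :
    observe H (v - w) = observe H v - observe H w := by
  simp [observe, Matrix.mulVec_sub]

lemma observe_firstThree_of_mem (hp : 3 ≤ p) {l : Fin d} (hl : l ∈ observedIdx d) (v : Vec d) :
    observe (firstThree p d) v
      ⟨l, (Finset.mem_filter.1 hl).2.trans_le hp⟩ = v l := by
  rw [observe_firstThree_apply, dif_pos ⟨(Finset.mem_filter.1 hl).2, l.2⟩]

lemma abs_apply_le_norm_observe (hp : 3 ≤ p) {l : Fin d} (hl : l ∈ observedIdx d) (v : Vec d) :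
    |v l| ≤ ‖observe (firstThree p d) v‖ := by
  rw [← observe_firstThree_of_mem hp hl v]
  exact PiLp.norm_apply_le (observe (firstThree p d) v) _

end Observe

/-! ### The assumption on the derivatives -/

/-- The exceptional points lie on the sphere or on finitely many coordinate hyperplanes, all null
sets. -/
theorem ae_mem_goodPoints (d : ℕ) (R : ℝ) (hR : 0 < R) :
    ∀ᵐ u ∂(volume.restrict (ballR d R)), u ∈ goodPoints d R := by
  have hmeas : MeasurableSet (ballR d R) := isCompact_ballR.isClosed.measurableSet
  rw [ae_restrict_iff' hmeas]
  have h1 : ∀ᵐ u : Vec d, ‖u‖ ≠ R := by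
    have := Measure.addHaar_sphere_of_ne_zero (volume : Measure (Vec d)) 0 hR.ne'
    filter_upwards [compl_mem_ae_iff.2 this] with u hu h
    exact hu (by simpa using h)
  have h2 : ∀ᵐ u : Vec d, ∀ i, u i ≠ 0 := by
    rw [ae_all_iff]
    intro i
    have hne : LinearMap.ker (EuclideanSpace.proj (𝕜 := ℝ) i : Vec d →L[ℝ] ℝ).toLinearMap ≠ ⊤ := by
      intro h
      have : EuclideanSpace.single i (1 : ℝ) ∈
          LinearMap.ker (EuclideanSpace.proj (𝕜 := ℝ) i : Vec d →L[ℝ] ℝ).toLinearMap := by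
        rw [h]; trivial
      simp at this
    have := Measure.addHaar_submodule (volume : Measure (Vec d)) _ hne
    filter_upwards [compl_mem_ae_iff.2 this] with u hu h
    exact hu (by simpa using h)
  filter_upwards [h1, h2] with u hu1 hu2 hu
  exact ⟨lt_of_le_of_ne hu hu1, hu2⟩

section DerivAssumption

variable {d p : ℕ} [NeZero d]

lemma isLittleO_derivGap {j : ℕ} {u w : Vec d}
    (h : ∀ i ≤ j, ∀ l ∈ observedIdx d,
      fderiv ℝ ((lieDeriv (lorenz96 d))^[i] (coord l)) u w = 0) :
    (fun s : ℝ => derivGap d j u (u + s • w)) =o[𝓝 0] fun s : ℝ => s := by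
  unfold derivGap
  refine Asymptotics.IsLittleO.fun_sum fun i hi => Asymptotics.IsLittleO.fun_sum fun l hl => ?_
  rw [Asymptotics.isLittleO_abs_left]
  set g := (lieDeriv (lorenz96 d))^[i] (coord l)
  have hg : DifferentiableAt ℝ g u :=
    differentiableAt_of_contDiff (contDiff_iterate_lieDeriv contDiff_lorenz96 (contDiff_coord l) i) u
  have h1 : HasDerivAt (fun s : ℝ => u + s • w) w 0 := by
    simpa using ((hasDerivAt_id (0 : ℝ)).smul_const w).const_add u
  have h2 : HasDerivAt (fun s : ℝ => g (u + s • w)) (fderiv ℝ g u w) 0 :=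
    HasFDerivAt.comp_hasDerivAt (0 : ℝ) (by simpa using hg.hasFDerivAt) h1
  rw [h i (Nat.lt_succ_iff.1 (Finset.mem_range.1 hi)) l hl] at h2
  simpa using hasDerivAt_iff_isLittleO_nhds_zero.1 h2

lemma observe_timeDeriv_apply (hd : 3 ≤ d) (hp : 3 ≤ p) (i : ℕ) {l : Fin d}
    (hl : l ∈ observedIdx d) (v : Vec d) :
    observe (firstThree p d) (timeDeriv (lorenz96 d) i v)
      ⟨l, (Finset.mem_filter.1 hl).2.trans_le hp⟩ = (lieDeriv (lorenz96 d))^[i] (coord l) v := by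
  rw [observe_firstThree_of_mem hp hl, (dissipative_lorenz96 hd).timeDeriv_apply]

theorem derivAssumption_lorenz96 (hd : 3 ≤ d) (hp : 3 ≤ p) {R : ℝ} {u : Vec d}
    (hu : u ∈ goodPoints d R) {j : ℕ} (hj : d - 3 ≤ j) :
    DerivAssumption (lorenz96 d) (firstThree p d) R j u := by
  obtain ⟨C, hC0, hC⟩ := exists_norm_sub_le_derivGap hd R hu.2 hj
  refine ⟨hu.1, fun v hv h => ?_, ?_⟩
  · have h0 : derivGap d j u v = 0 := by
      refine Finset.sum_eq_zero fun i hi => Finset.sum_eq_zero fun l hl => ?_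
      rw [← observe_timeDeriv_apply hd hp i hl, ← observe_timeDeriv_apply hd hp i hl,
        h i (Nat.lt_succ_iff.1 (Finset.mem_range.1 hi)), sub_self, abs_zero]
    have := hC v hv
    rw [h0, mul_zero] at this
    exact sub_eq_zero.1 (norm_le_zero_iff.1 this)
  -- Spanning is deduced from the stability estimate along the line `u + s • w`, with no computation
  -- of gradients.
  · rw [← Submodule.orthogonal_eq_bot_iff, Submodule.eq_bot_iff]
    intro w hw
    have h1 : ∀ i ≤ j, ∀ l ∈ observedIdx d,
        fderiv ℝ ((lieDeriv (lorenz96 d))^[i] (coord l)) u w = 0 := by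
      intro i hi l hl
      have h2 := (Submodule.mem_orthogonal _ _).1 hw _ (Submodule.subset_span
        ⟨i, hi, ⟨l, (Finset.mem_filter.1 hl).2.trans_le hp⟩, rfl⟩)
      simp only [observe_timeDeriv_apply hd hp i hl] at h2
      rwa [gradient, InnerProductSpace.toDual_symm_apply] at h2
    have h2 := (isLittleO_derivGap h1).const_mul_left C
    have hnear : ∀ᶠ s : ℝ in 𝓝 0, u + s • w ∈ ballR d R := by
      have hc : ContinuousAt (fun s : ℝ => ‖u + s • w‖) 0 := by fun_prop
      have hlt : ‖u + (0 : ℝ) • w‖ < R := by simpa using hu.1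
      filter_upwards [hc.eventually_lt_const hlt] with s hs using hs.le
    have h3 : (fun s : ℝ => s • w) =o[𝓝 0] fun s : ℝ => s := by
      refine Asymptotics.IsBigO.trans_isLittleO (Asymptotics.IsBigO.of_bound 1 ?_) h2
      filter_upwards [hnear] with s hs
      have := hC _ hs
      rw [add_sub_cancel_left] at this
      rw [one_mul]
      exact this.trans (le_abs_self _)
    have h4 : HasDerivAt (fun s : ℝ => s • w) 0 0 :=
      hasDerivAt_iff_isLittleO_nhds_zero.2 (by simpa using h3)
    have h5 : HasDerivAt (fun s : ℝ => s • w) w 0 := by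
      simpa using (hasDerivAt_id (0 : ℝ)).smul_const w
    exact h5.unique h4

end DerivAssumption

/-! ### Observations at discrete times -/

/-- The coefficients of a polynomial are bounded by its values at `0, …, j`. -/
lemma exists_abs_coeff_le (j : ℕ) : ∃ K, 0 ≤ K ∧ ∀ b : ℕ → ℝ, ∀ m ≤ j,
    |b m| ≤ K * ∑ i ∈ Finset.range (j + 1), |∑ n ∈ Finset.range (j + 1), b n * (i : ℝ) ^ n| := by
  -- Evaluation at the nodes `0, …, j` is a Vandermonde matrix; `K` is the sum of the absolute
  -- values of the entries of its inverse.
  let V : Matrix (Fin (j + 1)) (Fin (j + 1)) ℝ := Matrix.vandermonde fun i => (i : ℕ)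
  have hV : IsUnit V.det := by
    rw [isUnit_iff_ne_zero, Matrix.det_vandermonde_ne_zero_iff]
    intro a b h
    exact Fin.ext (Nat.cast_injective (R := ℝ) h)
  let K := ∑ m, ∑ i, |V⁻¹ m i|
  refine ⟨K, Finset.sum_nonneg fun _ _ => Finset.sum_nonneg fun _ _ => abs_nonneg _,
    fun b m hm => ?_⟩
  let β : Fin (j + 1) → ℝ := fun n => b n
  have hβ : V⁻¹.mulVec (V.mulVec β) = β := by
    rw [Matrix.mulVec_mulVec, Matrix.nonsing_inv_mul _ hV, Matrix.one_mulVec]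
  have hval : ∀ i : Fin (j + 1), V.mulVec β i = ∑ n ∈ Finset.range (j + 1), b n * ((i : ℕ) : ℝ) ^ n := by
    intro i
    rw [Finset.sum_range, Matrix.mulVec, dotProduct]
    exact Finset.sum_congr rfl fun n _ => by simp [V, β, Matrix.vandermonde_apply, mul_comm]
  rw [Finset.sum_range, show b m = β ⟨m, Nat.lt_succ_of_le hm⟩ from rfl, ← hβ, Finset.mul_sum]
  rw [Matrix.mulVec, dotProduct]
  refine (Finset.abs_sum_le_sum_abs _ _).trans (Finset.sum_le_sum fun i _ => ?_)
  rw [abs_mul, ← hval]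
  refine mul_le_mul_of_nonneg_right ?_ (abs_nonneg _)
  exact (Finset.single_le_sum (f := fun i => |V⁻¹ _ i|) (fun _ _ => abs_nonneg _)
    (Finset.mem_univ i)).trans (Finset.single_le_sum (f := fun m => ∑ i, |V⁻¹ m i|)
      (fun _ _ => Finset.sum_nonneg fun _ _ => abs_nonneg _) (Finset.mem_univ _))

section Discrete

variable {d p : ℕ} {F : Vec d → Vec d} {R : ℝ}

/-- Taylor's formula for the difference of two trajectories. -/
lemma Dissipative.exists_taylor_bound (hF : Dissipative F R) {g : Vec d → ℝ}
    (hg : ContDiff ℝ (⊤ : ℕ∞) g) (j : ℕ) (T : ℝ) : ∃ C, 0 ≤ C ∧ ∀ u ∈ ballR d R, ∀ v ∈ ballR d R,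
      ∀ t, 0 ≤ t → t ≤ T → |g (flow F t v) - g (flow F t u) - ∑ m ∈ Finset.range (j + 1),
        ((m.factorial : ℝ)⁻¹ * t ^ m) * ((lieDeriv F)^[m] g v - (lieDeriv F)^[m] g u)| ≤
        C * t ^ (j + 1) * ‖v - u‖ := by
  obtain ⟨K, hK⟩ := hF.exists_norm_flow_sub_le
  obtain ⟨L, hL⟩ := exists_lipschitzOnWith_ballR (R := R)
    (contDiff_iterate_lieDeriv hF.contDiff hg (j + 1))
  refine ⟨L * Real.exp (K * T), by positivity, fun u hu v hv t ht htT => ?_⟩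
  let f : ℕ → ℝ → ℝ := fun n t =>
    (lieDeriv F)^[n] g (flow F t v) - (lieDeriv F)^[n] g (flow F t u)
  have hf : ∀ n, ∀ t, 0 ≤ t → HasDerivWithinAt (f n) (f (n + 1) t) (Ici 0) t := by
    intro n t ht
    have h := contDiff_iterate_lieDeriv hF.contDiff hg n
    have := (hF.hasDerivWithinAt_comp_flow h v ht).fun_sub (hF.hasDerivWithinAt_comp_flow h u ht)
    simpa only [f, Function.iterate_succ_apply'] using this
  -- By Grönwall the remainder is proportional to `‖v - u‖`, which is what later allows it to be
  -- absorbed.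
  have hC : ∀ t, 0 ≤ t → t ≤ T → ‖f (j + 1) t‖ ≤ L * (‖v - u‖ * Real.exp (K * T)) := by
    intro t ht htT
    refine (hL.norm_sub_le (hF.flow_mem hv ht) (hF.flow_mem hu ht)).trans ?_
    refine mul_le_mul_of_nonneg_left ((hK v hv u hu t ht).trans ?_) L.2
    gcongr
  have := norm_sub_sum_le_of_hasDerivWithinAt hf hC ht htT
  simp only [f, smul_eq_mul, hF.flow_zero, Function.iterate_zero, id_eq, Real.norm_eq_abs] at this
  refine this.trans ?_
  have h1 : (1 : ℝ) ≤ j.factorial := by exact_mod_cast Nat.one_le_iff_ne_zero.2 j.factorial_ne_zero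
  refine (div_le_self (by positivity) h1).trans (le_of_eq (by ring))

/-- The derivatives of order at most `j` of the difference of two trajectories are controlled by
the values at the times `0, h, …, j h`, up to an error of order `h`. -/
lemma Dissipative.exists_deriv_gap_le (hF : Dissipative F R) {g : Vec d → ℝ}
    (hg : ContDiff ℝ (⊤ : ℕ∞) g) (j : ℕ) : ∃ K, 0 ≤ K ∧ ∀ h, 0 < h → h ≤ 1 →
      ∀ u ∈ ballR d R, ∀ v ∈ ballR d R, ∀ m ≤ j,
        |(lieDeriv F)^[m] g v - (lieDeriv F)^[m] g u| ≤
          K * (h ^ j)⁻¹ * ∑ i ∈ Finset.range (j + 1), |g (flow F (i * h) v) - g (flow F (i * h) u)|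
          + K * h * ‖v - u‖ := by
  obtain ⟨A, hA0, hA⟩ := exists_abs_coeff_le j
  obtain ⟨C, hC0, hC⟩ := hF.exists_taylor_bound hg j j
  let B : ℝ := ∑ i ∈ Finset.range (j + 1), C * (i : ℝ) ^ (j + 1)
  have hB0 : 0 ≤ B := Finset.sum_nonneg fun _ _ => by positivity
  let K : ℝ := j.factorial * A * (1 + B)
  refine ⟨K, by positivity, fun h h0 h1 u hu v hv m hm => ?_⟩
  set a : ℕ → ℝ := fun m => (lieDeriv F)^[m] g v - (lieDeriv F)^[m] g u
  set e : ℕ → ℝ := fun i => g (flow F (i * h) v) - g (flow F (i * h) u)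
  -- Scaling by `h ^ m` makes the Taylor polynomial at time `i * h` a polynomial in `i`, so the
  -- Vandermonde constant does not depend on `h`.
  let b : ℕ → ℝ := fun m => (m.factorial : ℝ)⁻¹ * h ^ m * a m
  have h2 : ∀ i ∈ Finset.range (j + 1), |∑ n ∈ Finset.range (j + 1), b n * (i : ℝ) ^ n| ≤
      |e i| + C * (i : ℝ) ^ (j + 1) * (h ^ (j + 1) * ‖v - u‖) := by
    intro i hi
    have hij : (i : ℝ) ≤ j := by exact_mod_cast Nat.lt_succ_iff.1 (Finset.mem_range.1 hi)
    have h3 := hC u hu v hv (i * h) (by positivity)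
      ((mul_le_of_le_one_right (Nat.cast_nonneg i) h1).trans hij)
    have h4 : ∑ m ∈ Finset.range (j + 1), ((m.factorial : ℝ)⁻¹ * (i * h) ^ m) * a m =
        ∑ n ∈ Finset.range (j + 1), b n * (i : ℝ) ^ n :=
      Finset.sum_congr rfl fun n _ => by simp only [b, mul_pow]; ring
    change |e i - ∑ m ∈ Finset.range (j + 1), ((m.factorial : ℝ)⁻¹ * (i * h) ^ m) * a m| ≤ _ at h3
    rw [h4, mul_pow, abs_sub_comm] at h3
    have h5 := abs_sub_abs_le_abs_sub (∑ n ∈ Finset.range (j + 1), b n * (i : ℝ) ^ n) (e i)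
    linarith
  have h3 : |b m| ≤ A * (∑ i ∈ Finset.range (j + 1), |e i| + B * (h ^ (j + 1) * ‖v - u‖)) := by
    refine (hA b m hm).trans (mul_le_mul_of_nonneg_left ?_ hA0)
    rw [Finset.sum_mul, ← Finset.sum_add_distrib]
    exact Finset.sum_le_sum h2
  set E := ∑ i ∈ Finset.range (j + 1), |e i|
  have hE0 : 0 ≤ E := Finset.sum_nonneg fun _ _ => abs_nonneg _
  have h4 : |a m| * h ^ j ≤ j.factorial * |b m| := by
    have : |b m| = (m.factorial : ℝ)⁻¹ * h ^ m * |a m| := by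
      simp only [b, abs_mul, abs_of_pos (pow_pos h0 m)]
      rw [abs_of_pos (by positivity)]
    rw [this]
    have hf : (1 : ℝ) ≤ j.factorial * (m.factorial : ℝ)⁻¹ := by
      rw [← div_eq_mul_inv, one_le_div (by positivity)]
      exact_mod_cast Nat.factorial_le hm
    have hh : h ^ j ≤ h ^ m := pow_le_pow_of_le_one h0.le h1 hm
    calc |a m| * h ^ j ≤ |a m| * h ^ m * 1 := by
          rw [mul_one]; exact mul_le_mul_of_nonneg_left hh (abs_nonneg _)
      _ ≤ |a m| * h ^ m * (j.factorial * (m.factorial : ℝ)⁻¹) :=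
          mul_le_mul_of_nonneg_left hf (by positivity)
      _ = _ := by ring
  have hj : 0 < h ^ j := pow_pos h0 j
  have h5 : |a m| * h ^ j ≤ (K * (h ^ j)⁻¹ * E + K * h * ‖v - u‖) * h ^ j := by
    refine (h4.trans (mul_le_mul_of_nonneg_left h3 (by positivity))).trans ?_
    have e1 : (K * (h ^ j)⁻¹ * E + K * h * ‖v - u‖) * h ^ j
        = K * E + K * (h ^ (j + 1) * ‖v - u‖) := by
      field_simp
      ring
    rw [e1]
    have e2 : (j.factorial : ℝ) * (A * (E + B * (h ^ (j + 1) * ‖v - u‖)))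
        = j.factorial * A * E + j.factorial * A * B * (h ^ (j + 1) * ‖v - u‖) := by ring
    have hfA : 0 ≤ (j.factorial : ℝ) * A := by positivity
    rw [e2]
    gcongr
    · exact le_mul_of_one_le_right hfA (by linarith)
    · exact mul_le_mul_of_nonneg_left (by linarith) hfA
  exact le_of_mul_le_mul_right h5 hj

/-- The initial points are determined by the observations in a Lipschitz way around `u`. -/
theorem exists_norm_sub_le_observe [NeZero d] (hd : 3 ≤ d) (hp : 3 ≤ p)
    (hR : Dissipative (lorenz96 d) R) {u : Vec d} (hu : u ∈ goodPoints d R) :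
    ∃ h₀ : ℝ, 0 < h₀ ∧ ∀ h : ℝ, 0 < h → h < h₀ → ∀ k : ℕ, d - 3 ≤ k → ∃ C : ℝ≥0,
      ∀ v ∈ ballR d R, ‖v - u‖ ≤ C * ∑ i : Fin (k + 1),
        ‖observe (firstThree p d) (flow (lorenz96 d) ((i : ℕ) * h) v)
          - observe (firstThree p d) (flow (lorenz96 d) ((i : ℕ) * h) u)‖ := by
  -- Only the first `d - 2` observations are used, whatever `k` is, so `h₀` does not depend on `k`.
  set j := d - 3
  have huR : u ∈ ballR d R := hu.1.le
  obtain ⟨C, hC0, hC⟩ := exists_norm_sub_le_derivGap hd R hu.2 (le_refl j)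
  choose K hK0 hK using fun l : Fin d => hR.exists_deriv_gap_le (contDiff_coord l) j
  let Q : ℝ := ∑ i ∈ Finset.range (j + 1), ∑ l ∈ observedIdx d, K l
  have hQ0 : 0 ≤ Q := Finset.sum_nonneg fun _ _ => Finset.sum_nonneg fun _ _ => hK0 _
  -- This choice makes the error coefficient `C * Q * h` at most `1 / 2`; absorbing it on the left
  -- doubles the final constant.
  refine ⟨min 1 (2 * C * Q + 1)⁻¹, by positivity, fun h h0 hlt k hk => ?_⟩
  have h1 : h ≤ 1 := hlt.le.trans (min_le_left _ _)
  have h2 : C * Q * h ≤ 1 / 2 := by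
    have : h * (2 * C * Q + 1) < 1 := by
      have := hlt.trans_le (min_le_right _ _)
      rwa [lt_inv_comm₀ h0 (by positivity), lt_inv_comm₀ (by positivity) h0, ← one_div,
        lt_div_iff₀ (by positivity)] at this
    nlinarith
  refine ⟨⟨2 * (C * (Q * (h ^ j)⁻¹)), by positivity⟩, fun v hv => ?_⟩
  set N : ℕ → ℝ := fun i => ‖observe (firstThree p d) (flow (lorenz96 d) (i * h) v)
          - observe (firstThree p d) (flow (lorenz96 d) (i * h) u)‖
  have hN : ∑ i ∈ Finset.range (j + 1), N i ≤ ∑ i : Fin (k + 1), N i := by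
    rw [← Finset.sum_range]
    exact Finset.sum_le_sum_of_subset_of_nonneg (Finset.range_mono (by omega))
      fun _ _ _ => norm_nonneg _
  set NS := ∑ i : Fin (k + 1), N i
  have hgap : derivGap d j u v ≤ Q * (h ^ j)⁻¹ * NS + Q * h * ‖v - u‖ := by
    have e1 : Q * (h ^ j)⁻¹ * NS + Q * h * ‖v - u‖ = ∑ i ∈ Finset.range (j + 1),
        ∑ l ∈ observedIdx d, (K l * (h ^ j)⁻¹ * NS + K l * h * ‖v - u‖) := by
      simp only [Q, Finset.sum_mul, Finset.sum_add_distrib]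
    rw [e1]
    refine Finset.sum_le_sum fun i hi => Finset.sum_le_sum fun l hl => ?_
    refine (hK l h h0 h1 u huR v hv i (Nat.lt_succ_iff.1 (Finset.mem_range.1 hi))).trans ?_
    have hl0 := hK0 l
    gcongr
    refine le_trans (Finset.sum_le_sum fun i _ => ?_) hN
    simp only [N, ← observe_sub]
    exact abs_apply_le_norm_observe hp hl
      (flow (lorenz96 d) (i * h) v - flow (lorenz96 d) (i * h) u)
  have h3 := (hC v hv).trans (mul_le_mul_of_nonneg_left hgap hC0)
  have h4 : C * Q * h * ‖v - u‖ ≤ 1 / 2 * ‖v - u‖ :=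
    mul_le_mul_of_nonneg_right h2 (norm_nonneg _)
  change ‖v - u‖ ≤ 2 * (C * (Q * (h ^ j)⁻¹)) * NS
  linarith

end Discrete

/-! ### Supports of the smoother and of the filter -/

section Support

variable {d p : ℕ} {F : Vec d → Vec d} {H : Matrix (Fin p) (Fin d) ℝ} {R h : ℝ} {k : ℕ}
  {η : Vec p → ℝ≥0∞} {q : Vec d → ℝ≥0∞}

lemma norm_observe_sub_le {u v : Vec d} {ε : ℝ} {z : ℕ → Vec p} {i : Fin (k + 1)}
    (hη : ∀ z : Vec p, ε < ‖z‖ → η z = 0) (hz : ‖z i‖ ≤ ε)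
    (hne : η (observations F H h k u z i - observe H v) ≠ 0) :
    ‖observe H v - observe H (flow F ((i : ℕ) * h) u)‖ ≤ 2 * ε := by
  have h1 : ‖observations F H h k u z i - observe H v‖ ≤ ε := not_lt.1 fun hlt => hne (hη _ hlt)
  have h2 : observe H v - observe H (flow F ((i : ℕ) * h) u)
      = z i - (observations F H h k u z i - observe H v) := by
    simp only [observations]; abel
  rw [h2]
  linarith [norm_sub_le (z i) (observations F H h k u z i - observe H v)]

lemma support_smootherDensity_subset {u : Vec d} {ε : ℝ} {z : ℕ → Vec p}
    (hη : ∀ z : Vec p, ε < ‖z‖ → η z = 0) (hz : ∀ i, ‖z i‖ ≤ ε) :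
    Function.support (smootherDensity F H R h k η q (observations F H h k u z)) ⊆
      {v ∈ ballR d R | ∀ i : Fin (k + 1), ‖observe H (flow F ((i : ℕ) * h) v)
        - observe H (flow F ((i : ℕ) * h) u)‖ ≤ 2 * ε} := by
  intro v hv
  -- A zero weight gives a zero density whatever the normalising integral is, even `0` or `∞`.
  have h1 : smootherWeight F H R h k η q (observations F H h k u z) v ≠ 0 := fun h0 =>
    hv (by rw [smootherDensity, h0, ENNReal.zero_div])
  have h2 := Set.mem_of_indicator_ne_zero h1
  rw [smootherWeight, Set.indicator_of_mem h2] at h1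
  exact ⟨h2, fun i => norm_observe_sub_le hη (hz i)
    (Finset.prod_ne_zero_iff.1 (left_ne_zero_of_mul h1) i (Finset.mem_univ i))⟩

/-- By the semigroup law and injectivity, going back from `flow F (k * h) w` by `k * h - i * h`
gives the state of `w` at time `i * h`. The constraints are thus those of the smoother, transported
by the flow. -/
lemma Dissipative.support_filterDensity_subset (hF : Dissipative F R) (h0 : 0 ≤ h) {u : Vec d}
    {ε : ℝ} {z : ℕ → Vec p} (hη : ∀ z : Vec p, ε < ‖z‖ → η z = 0) (hz : ∀ i, ‖z i‖ ≤ ε) :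
    Function.support (filterDensity F H R h k η q (observations F H h k u z)) ⊆
      flow F (k * h) '' {v ∈ ballR d R | ∀ i : Fin (k + 1), ‖observe H (flow F ((i : ℕ) * h) v)
        - observe H (flow F ((i : ℕ) * h) u)‖ ≤ 2 * ε} := by
  intro v hv
  have h1 : filterWeight F H R h k η q (observations F H h k u z) v ≠ 0 := fun h0 =>
    hv (by rw [filterDensity, h0, ENNReal.zero_div])
  have h2 := Set.mem_of_indicator_ne_zero h1
  rw [filterWeight, Set.indicator_of_mem h2] at h1
  obtain ⟨w, hw, rfl⟩ := h2
  refine ⟨w, ⟨hw, fun i => ?_⟩, rfl⟩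
  have h3 := Finset.prod_ne_zero_iff.1 (left_ne_zero_of_mul (left_ne_zero_of_mul h1)) i
    (Finset.mem_univ i)
  have hi : 0 ≤ ((i : ℕ) : ℝ) * h := by positivity
  have hki : 0 ≤ (k : ℝ) * h - (i : ℕ) * h := by
    rw [← sub_mul]
    have : ((i : ℕ) : ℝ) ≤ k := by exact_mod_cast Nat.lt_succ_iff.1 i.2
    exact mul_nonneg (by linarith) h0
  have h4 : flow F (k * h) w = flow F (k * h - (i : ℕ) * h) (flow F ((i : ℕ) * h) w) := by
    rw [← hF.flow_add hw hi hki]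
    congr 1
    ring
  rw [h4, hF.flowInv_flow (hF.flow_mem hw hi) hki] at h3
  exact norm_observe_sub_le hη (hz i) h3

/-- The points of the ball whose observations are close to those of `u`. -/
lemma norm_sub_le_of_observe {u v : Vec d} {C ε : ℝ} (hC0 : 0 ≤ C) (hv : v ∈ ballR d R)
    (hC : ∀ v ∈ ballR d R, ‖v - u‖ ≤ C * ∑ i : Fin (k + 1),
        ‖observe H (flow F ((i : ℕ) * h) v) - observe H (flow F ((i : ℕ) * h) u)‖)
    (hε : ∀ i : Fin (k + 1), ‖observe H (flow F ((i : ℕ) * h) v)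
        - observe H (flow F ((i : ℕ) * h) u)‖ ≤ 2 * ε) :
    ‖v - u‖ ≤ 2 * C * (k + 1) * ε := by
  refine (hC v hv).trans ((mul_le_mul_of_nonneg_left (Finset.sum_le_sum fun i _ => hε i)
    hC0).trans (le_of_eq ?_))
  simp
  ring

end Support

/-! ### Least squares estimators -/

/-- A continuous function on a compact metric space that depends continuously on a parameter has a
measurable choice of minimisers. -/
theorem exists_measurable_argmin {X E : Type*} [TopologicalSpace X] [MeasurableSpace X]
    [OpensMeasurableSpace X] [MetricSpace E] [CompactSpace E] [Nonempty E] [MeasurableSpace E]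
    [BorelSpace E] {φ : X → E → ℝ} (hφ : Continuous (Function.uncurry φ)) :
    ∃ s : X → E, Measurable s ∧ ∀ x e, φ x (s x) ≤ φ x e := by
  -- Writing `E` as a continuous image of the Cantor set orders the candidates: the minimisers pull
  -- back to a compact set of reals, whose least element is a canonical choice.
  obtain ⟨π, hπ, hπs⟩ := exists_nat_bool_continuous_surjective_of_compact E
  let f : cantorSet → E := fun c => π (cantorSetHomeomorphNatToBool c)
  have hf : Continuous f := hπ.comp cantorSetHomeomorphNatToBool.continuous
  have hfs : Function.Surjective f := hπs.comp cantorSetHomeomorphNatToBool.surjective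
  have : CompactSpace cantorSet := isCompact_iff_compactSpace.1 isCompact_cantorSet
  have : Nonempty cantorSet := hfs.nonempty
  let A : X → Set cantorSet := fun x => {c | ∀ c', φ x (f c) ≤ φ x (f c')}
  have hφf : ∀ x, Continuous fun c => φ x (f c) := fun x =>
    hφ.comp (continuous_const.prodMk hf)
  have hA : ∀ x, ∃ c, IsLeast (A x) c := by
    intro x
    have hne : (A x).Nonempty := by
      obtain ⟨c, -, hc⟩ := isCompact_univ.exists_isMinOn univ_nonempty (hφf x).continuousOn
      exact ⟨c, fun c' => hc (mem_univ c')⟩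
    have hcl : IsClosed (A x) := by
      simp only [A, ofPred_forall]
      exact isClosed_iInter fun c' => isClosed_le (hφf x) continuous_const
    exact hcl.isCompact.exists_isLeast hne
  choose s hs using hA
  refine ⟨fun x => f (s x), hf.measurable.comp ?_, fun x e => ?_⟩
  · have hmeas : Measurable fun x => (s x : ℝ) := by
      refine measurable_of_Iic fun a => ?_
      let B : Set (X × cantorSet) := {y | (y.2 : ℝ) ≤ a ∧ ∀ c', φ y.1 (f y.2) ≤ φ y.1 (f c')}
      have hB : IsClosed B := by
        simp only [B, ofPred_and, ofPred_forall]
        refine (isClosed_le (by fun_prop) continuous_const).inter (isClosed_iInter fun c' => ?_)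
        exact isClosed_le (hφ.comp (continuous_fst.prodMk (hf.comp continuous_snd)))
          (hφ.comp (continuous_fst.prodMk continuous_const))
      -- The least minimiser is at most `a` exactly when some minimiser is, so this set is the
      -- projection of a closed set along a compact factor, hence closed.
      have : (fun x => (s x : ℝ)) ⁻¹' Iic a = Prod.fst '' B := by
        ext x
        constructor
        · intro hx
          exact ⟨(x, s x), ⟨hx, (hs x).1⟩, rfl⟩
        · rintro ⟨⟨x', c⟩, ⟨hc, hc'⟩, rfl⟩
          exact le_trans (Subtype.coe_le_coe.2 ((hs x').2 hc')) hc
      rw [this]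
      exact (isClosedMap_fst_of_compactSpace _ hB).measurableSet
    exact hmeas.subtype_mk
  · obtain ⟨c, rfl⟩ := hfs e
    exact (hs x).1 c

section LeastSquares

variable {d p : ℕ} {F : Vec d → Vec d} {R : ℝ}

lemma continuous_observe (H : Matrix (Fin p) (Fin d) ℝ) : Continuous (observe H) := by
  unfold observe
  fun_prop

lemma Dissipative.exists_leastSquares (hF : Dissipative F R) (hR : 0 ≤ R)
    (H : Matrix (Fin p) (Fin d) ℝ) (h : ℝ) (k : ℕ) :
    ∃ U : (Fin (k + 1) → Vec p) → ballR d R, Measurable U ∧ (0 < h → ∀ Y, ∀ v ∈ ballR d R,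
      ∑ i : Fin (k + 1), ‖Y i - observe H (flow F ((i : ℕ) * h) (U Y))‖ ^ 2 ≤
      ∑ i : Fin (k + 1), ‖Y i - observe H (flow F ((i : ℕ) * h) v)‖ ^ 2) := by
  have hne : Nonempty (ballR d R) := ⟨⟨0, by simpa [ballR] using hR⟩⟩
  by_cases h0 : 0 < h
  · have : CompactSpace (ballR d R) := isCompact_iff_compactSpace.1 isCompact_ballR
    let φ : (Fin (k + 1) → Vec p) → ballR d R → ℝ := fun Y v =>
      ∑ i : Fin (k + 1), ‖Y i - observe H (flow F ((i : ℕ) * h) v)‖ ^ 2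
    have hφ : Continuous (Function.uncurry φ) := by
      refine continuous_finsetSum _ fun i _ => ((Continuous.sub ?_ ?_).norm.pow 2)
      · exact (continuous_apply i).comp continuous_fst
      · refine (continuous_observe H).comp ?_
        exact (continuousOn_iff_continuous_domRestrict.1
          (hF.continuousOn_flow (by positivity))).comp continuous_snd
    obtain ⟨U, hU, hmin⟩ := exists_measurable_argmin hφ
    exact ⟨U, hU, fun _ Y v hv => hmin Y ⟨v, hv⟩⟩
  · exact ⟨fun _ => hne.some, measurable_const, fun h1 => absurd h1 h0⟩

/-- The fit `b` has a residual no larger than the noise `z`. The triangle inequality gives the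
factor `4`, Cauchy–Schwarz the cardinality. -/
lemma sq_sum_norm_sub_le {ι E : Type*} [Fintype ι] [SeminormedAddCommGroup E] {a b z : ι → E}
    (h : ∑ i, ‖a i + z i - b i‖ ^ 2 ≤ ∑ i, ‖z i‖ ^ 2) :
    (∑ i, ‖b i - a i‖) ^ 2 ≤ Fintype.card ι * 4 * ∑ i, ‖z i‖ ^ 2 := by
  have h1 : ∀ i, ‖b i - a i‖ ^ 2 ≤ 2 * ‖a i + z i - b i‖ ^ 2 + 2 * ‖z i‖ ^ 2 := by
    intro i
    have h2 : ‖b i - a i‖ ≤ ‖z i‖ + ‖a i + z i - b i‖ := by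
      refine le_trans (le_of_eq ?_) (norm_sub_le _ _)
      congr 1
      abel
    have h3 := pow_le_pow_left₀ (norm_nonneg _) h2 2
    have h4 := sq_nonneg (‖z i‖ - ‖a i + z i - b i‖)
    linarith
  have h2 : ∑ i, ‖b i - a i‖ ^ 2 ≤ 4 * ∑ i, ‖z i‖ ^ 2 := by
    refine (Finset.sum_le_sum fun i _ => h1 i).trans ?_
    rw [Finset.sum_add_distrib, ← Finset.mul_sum, ← Finset.mul_sum]
    linarith
  have h3 := sq_sum_le_card_mul_sum_sq (s := Finset.univ) (f := fun i => ‖b i - a i‖)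
  rw [mul_assoc]
  exact h3.trans (mul_le_mul_of_nonneg_left h2 (Nat.cast_nonneg _))

lemma norm_sq_sub_le_of_leastSquares {H : Matrix (Fin p) (Fin d) ℝ} {h : ℝ} {k : ℕ} {u v : Vec d}
    {C : ℝ} {z : ℕ → Vec p}
    (hC : ‖v - u‖ ≤ C * ∑ i : Fin (k + 1),
        ‖observe H (flow F ((i : ℕ) * h) v) - observe H (flow F ((i : ℕ) * h) u)‖)
    (hmin : ∑ i : Fin (k + 1), ‖observations F H h k u z i - observe H (flow F ((i : ℕ) * h) v)‖ ^ 2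
      ≤ ∑ i : Fin (k + 1), ‖observations F H h k u z i - observe H (flow F ((i : ℕ) * h) u)‖ ^ 2) :
    ‖v - u‖ ^ 2 ≤ C ^ 2 * (k + 1) * 4 * ∑ i : Fin (k + 1), ‖z i‖ ^ 2 := by
  have hz : ∀ i : Fin (k + 1),
      observations F H h k u z i - observe H (flow F ((i : ℕ) * h) u) = z i := by
    intro i
    simp only [observations, add_sub_cancel_left]
  simp only [hz] at hmin
  have h1 := sq_sum_norm_sub_le hmin
  have h2 := pow_le_pow_left₀ (norm_nonneg _) hC 2
  rw [mul_pow] at h2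
  rw [Fintype.card_fin, Nat.cast_add, Nat.cast_one] at h1
  refine h2.trans ((mul_le_mul_of_nonneg_left h1 (sq_nonneg C)).trans (le_of_eq ?_))
  ring

lemma enorm_sq_le_of_norm_sq_le {ι E G : Type*} [SeminormedAddCommGroup E]
    [SeminormedAddCommGroup G] {s : Finset ι} {x : E} {z : ι → G} {D : ℝ≥0}
    (h : ‖x‖ ^ 2 ≤ D * ∑ i ∈ s, ‖z i‖ ^ 2) : ‖x‖ₑ ^ 2 ≤ D * ∑ i ∈ s, ‖z i‖ₑ ^ 2 := by
  simp only [enorm_eq_nnnorm]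
  have : ‖x‖₊ ^ 2 ≤ D * ∑ i ∈ s, ‖z i‖₊ ^ 2 := by
    rw [← NNReal.coe_le_coe]
    push_cast
    exact h
  exact_mod_cast this

lemma IsNoise.lintegral_sum_enorm_sq {Ω : Type*} [MeasurableSpace Ω] {P : Measure Ω}
    {Z : ℕ → Ω → Vec p} {η : Vec p → ℝ≥0∞} (hZ : IsNoise P Z η) (k : ℕ) :
    ∫⁻ ω, ∑ i : Fin (k + 1), ‖Z i ω‖ₑ ^ 2 ∂P = (k + 1) * ∫⁻ ω, ‖Z 0 ω‖ₑ ^ 2 ∂P := by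
  have h : ∀ i, ∫⁻ ω, ‖Z i ω‖ₑ ^ 2 ∂P = ∫⁻ ω, ‖Z 0 ω‖ₑ ^ 2 ∂P := by
    intro i
    have hm : Measurable fun z : Vec p => ‖z‖ₑ ^ 2 := by fun_prop
    rw [← lintegral_map hm (hZ.measurable i), ← lintegral_map hm (hZ.measurable 0), hZ.law,
      hZ.law]
  rw [lintegral_finsetSum Finset.univ fun (i : Fin (k + 1)) _ =>
    (hZ.measurable i).enorm.pow_const 2]
  simp [h]

lemma IsNoise.lintegral_enorm_sq_le {Ω E : Type*} [MeasurableSpace Ω] {P : Measure Ω}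
    [SeminormedAddCommGroup E] {Z : ℕ → Ω → Vec p} {η : Vec p → ℝ≥0∞} (hZ : IsNoise P Z η) {k : ℕ}
    {D : ℝ≥0} {f : Ω → E} (hf : ∀ ω, ‖f ω‖ ^ 2 ≤ D * ∑ i : Fin (k + 1), ‖Z i ω‖ ^ 2) :
    ∫⁻ ω, ‖f ω‖ₑ ^ 2 ∂P ≤ (D * (k + 1) : ℝ≥0) * ∫⁻ ω, ‖Z 0 ω‖ₑ ^ 2 ∂P := by
  refine (lintegral_mono fun ω => enorm_sq_le_of_norm_sq_le (hf ω)).trans ?_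
  rw [lintegral_const_mul' _ _ ENNReal.coe_ne_top, hZ.lintegral_sum_enorm_sq, ← mul_assoc]
  push_cast
  rfl

end LeastSquares

end ObservedODE

/-! ### Assembly of the claims. -/

theorem mainTheorem12 (d : ℕ) [NeZero d] (hd : 3 ≤ d) (p : ℕ) (hp : 3 ≤ p) (R : ℝ)
    (hR : ObservedODE.TrappingBall (ObservedODE.lorenz96 d) R) :
    -- almost every point of the ball is good
    (∀ᵐ u ∂(volume.restrict (ObservedODE.ballR d R)), u ∈ ObservedODE.goodPoints d R) ∧
    -- at every good point the assumption on the derivatives holds for every `j ≥ d - 3`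
    (∀ u ∈ ObservedODE.goodPoints d R, ∀ j : ℕ, d - 3 ≤ j →
      ObservedODE.DerivAssumption (ObservedODE.lorenz96 d) (ObservedODE.firstThree p d) R j u) ∧
    -- bounded noise: supports of the smoother and of the filter
    (∀ u ∈ ObservedODE.goodPoints d R, ∃ h₀ : ℝ, 0 < h₀ ∧ ∀ h : ℝ, 0 < h → h < h₀ →
      ∀ k : ℕ, d - 3 ≤ k → ∃ Csm Cfi : ℝ≥0,
      ∀ (Ω : Type*) [MeasurableSpace Ω] (P : Measure Ω) [IsProbabilityMeasure P]
        (Z : ℕ → Ω → ObservedODE.Vec p) (η : ObservedODE.Vec p → ℝ≥0∞)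
        (q : ObservedODE.Vec d → ℝ≥0∞) (ε : ℝ≥0),
        ObservedODE.IsNoise P Z η → ObservedODE.IsPrior R q → 0 < ε →
        (∀ i, ∀ᵐ ω ∂P, ‖Z i ω‖ ≤ ε) → (∀ z : ObservedODE.Vec p, ε < ‖z‖ → η z = 0) →
        ∀ᵐ ω ∂P,
          Metric.ediam (Function.support
            (ObservedODE.smootherDensity (ObservedODE.lorenz96 d) (ObservedODE.firstThree p d)
              R h k η q (ObservedODE.observations (ObservedODE.lorenz96 d)
                (ObservedODE.firstThree p d) h k u (fun i => Z i ω)))) ≤ Csm * ε ∧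
          Metric.ediam (Function.support
            (ObservedODE.filterDensity (ObservedODE.lorenz96 d) (ObservedODE.firstThree p d)
              R h k η q (ObservedODE.observations (ObservedODE.lorenz96 d)
                (ObservedODE.firstThree p d) h k u (fun i => Z i ω)))) ≤ Cfi * ε) ∧
    -- square integrable noise: estimators, chosen independently of `u` and of the noise
    (∃ Usm Ufi : (h : ℝ) → (k : ℕ) → (Fin (k + 1) → ObservedODE.Vec p) → ObservedODE.Vec d,
      (∀ h k, Measurable (Usm h k) ∧ Measurable (Ufi h k)) ∧
      ∀ u ∈ ObservedODE.goodPoints d R, ∃ h₀ : ℝ, 0 < h₀ ∧ ∀ h : ℝ, 0 < h → h < h₀ →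
        ∀ k : ℕ, d - 3 ≤ k → ∃ Dsm Dfi : ℝ≥0,
        ∀ (Ω : Type*) [MeasurableSpace Ω] (P : Measure Ω) [IsProbabilityMeasure P]
          (Z : ℕ → Ω → ObservedODE.Vec p) (η : ObservedODE.Vec p → ℝ≥0∞),
          ObservedODE.IsNoise P Z η → MemLp (Z 0) 2 P →
          ∫⁻ ω, ‖Usm h k (ObservedODE.observations (ObservedODE.lorenz96 d)
              (ObservedODE.firstThree p d) h k u (fun i => Z i ω)) - u‖ₑ ^ 2 ∂P
            ≤ Dsm * ∫⁻ ω, ‖Z 0 ω‖ₑ ^ 2 ∂P ∧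
          ∫⁻ ω, ‖Ufi h k (ObservedODE.observations (ObservedODE.lorenz96 d)
              (ObservedODE.firstThree p d) h k u (fun i => Z i ω))
              - ObservedODE.flow (ObservedODE.lorenz96 d) (k * h) u‖ₑ ^ 2 ∂P
            ≤ Dfi * ∫⁻ ω, ‖Z 0 ω‖ₑ ^ 2 ∂P) := by
  have hF := ObservedODE.TrappingBall.dissipative hd hR
  obtain ⟨K, hK⟩ := hF.exists_norm_flow_sub_le
  have hKd : ∀ v ∈ ObservedODE.ballR d R, ∀ w ∈ ObservedODE.ballR d R, ∀ t : ℝ, 0 ≤ t →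
      ‖ObservedODE.flow (ObservedODE.lorenz96 d) t v - ObservedODE.flow (ObservedODE.lorenz96 d) t w‖
        ≤ (Real.exp (K * t)).toNNReal * ‖v - w‖ := by
    intro v hv w hw t ht
    rw [Real.coe_toNNReal _ (Real.exp_pos _).le, mul_comm]
    exact hK v hv w hw t ht
  refine ⟨ObservedODE.ae_mem_goodPoints d R hR.1,
    fun u hu j hj => ObservedODE.derivAssumption_lorenz96 hd hp hu hj, fun u hu => ?_, ?_⟩
  · obtain ⟨h₀, h₀pos, hobs⟩ := ObservedODE.exists_norm_sub_le_observe hd hp hF hu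
    refine ⟨h₀, h₀pos, fun h h0 hlt k hk => ?_⟩
    obtain ⟨C, hC⟩ := hobs h h0 hlt k hk
    have hkh : 0 ≤ (k : ℝ) * h := by positivity
    -- Support points of the smoother lie within `2 * C * (k + 1) * ε` of `u`, and the diameter
    -- doubles this. The filter adds the Lipschitz constant of the flow at time `k * h`.
    refine ⟨4 * C * (k + 1), (Real.exp (K * (k * h))).toNNReal * (4 * C * (k + 1)), ?_⟩
    intro Ω _ P _ Z η q ε hZ hq hε hbd hη
    filter_upwards [ae_all_iff.2 hbd] with ω hω
    have hdist : ∀ v ∈ ObservedODE.ballR d R, ∀ w ∈ ObservedODE.ballR d R,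
        (∀ i : Fin (k + 1), ‖ObservedODE.observe (ObservedODE.firstThree p d)
            (ObservedODE.flow (ObservedODE.lorenz96 d) ((i : ℕ) * h) v)
          - ObservedODE.observe (ObservedODE.firstThree p d)
            (ObservedODE.flow (ObservedODE.lorenz96 d) ((i : ℕ) * h) u)‖ ≤ 2 * ε) →
        (∀ i : Fin (k + 1), ‖ObservedODE.observe (ObservedODE.firstThree p d)
            (ObservedODE.flow (ObservedODE.lorenz96 d) ((i : ℕ) * h) w)
          - ObservedODE.observe (ObservedODE.firstThree p d)
            (ObservedODE.flow (ObservedODE.lorenz96 d) ((i : ℕ) * h) u)‖ ≤ 2 * ε) →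
        ‖v - w‖ ≤ 4 * C * (k + 1) * ε := by
      intro v hv w hw hv' hw'
      have h1 := ObservedODE.norm_sub_le_of_observe C.2 hv hC hv'
      have h2 := ObservedODE.norm_sub_le_of_observe C.2 hw hC hw'
      have h3 := norm_sub_le_norm_sub_add_norm_sub v u w
      rw [norm_sub_rev u w] at h3
      simp only [NNReal.val_eq_coe] at h1 h2
      linarith
    constructor
    · refine (Metric.ediam_mono
        (ObservedODE.support_smootherDensity_subset hη hω)).trans (Metric.ediam_le ?_)
      intro v hv w hw
      rw [← ENNReal.coe_mul, edist_le_coe, ← NNReal.coe_le_coe, coe_nndist, dist_eq_norm]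
      exact hdist v hv.1 w hw.1 hv.2 hw.2
    · refine (Metric.ediam_mono
        (hF.support_filterDensity_subset h0.le hη hω)).trans (Metric.ediam_le ?_)
      rintro _ ⟨v, hv, rfl⟩ _ ⟨w, hw, rfl⟩
      rw [← ENNReal.coe_mul, edist_le_coe, ← NNReal.coe_le_coe, coe_nndist, dist_eq_norm]
      refine (hKd v hv.1 w hw.1 _ hkh).trans ?_
      push_cast
      rw [mul_assoc]
      exact mul_le_mul_of_nonneg_left (hdist v hv.1 w hw.1 hv.2 hw.2) NNReal.zero_le_coe
  · choose U hU hmin using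
      fun h k => hF.exists_leastSquares hR.1.le (ObservedODE.firstThree p d) h k
    refine ⟨fun h k Y => U h k Y,
      -- The filter estimator transports the smoother estimator by the flow. The value `0` for `h ≤
      -- 0` keeps it measurable where the flow has no meaning.
      fun h k Y => if 0 < h then ObservedODE.flow (ObservedODE.lorenz96 d) (k * h) (U h k Y) else 0,
      fun h k => ⟨measurable_subtype_coe.comp (hU h k), ?_⟩, fun u hu => ?_⟩
    · by_cases h0 : 0 < h
      · simp only [if_pos h0]
        have hc := continuousOn_iff_continuous_domRestrict.1
          (hF.continuousOn_flow (t := k * h) (by positivity))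
        exact hc.measurable.comp (hU h k)
      · simp only [if_neg h0]
        exact measurable_const
    obtain ⟨h₀, h₀pos, hobs⟩ := ObservedODE.exists_norm_sub_le_observe hd hp hF hu
    refine ⟨h₀, h₀pos, fun h h0 hlt k hk => ?_⟩
    obtain ⟨C, hC⟩ := hobs h h0 hlt k hk
    have huR : u ∈ ObservedODE.ballR d R := hu.1.le
    have hkh : 0 ≤ (k : ℝ) * h := by positivity
    set L := (Real.exp (K * (k * h))).toNNReal
    -- The factor `C ^ 2 * (k + 1) * 4` is the pathwise least squares bound; the last `k + 1` comes
    -- from summing `k + 1` equal second moments.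
    refine ⟨C ^ 2 * (k + 1) * 4 * (k + 1), L ^ 2 * (C ^ 2 * (k + 1) * 4) * (k + 1), ?_⟩
    intro Ω _ P _ Z η hZ _
    have hest : ∀ ω, ‖(U h k (ObservedODE.observations (ObservedODE.lorenz96 d)
        (ObservedODE.firstThree p d) h k u (fun i => Z i ω)) : ObservedODE.Vec d) - u‖ ^ 2 ≤
        (C ^ 2 * (k + 1) * 4 : ℝ≥0) * ∑ i : Fin (k + 1), ‖Z i ω‖ ^ 2 := fun ω => by
      push_cast
      exact ObservedODE.norm_sq_sub_le_of_leastSquares (z := fun i => Z i ω)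
        (hC _ (U h k _).2) (hmin h k h0 _ u huR)
    refine ⟨hZ.lintegral_enorm_sq_le hest, hZ.lintegral_enorm_sq_le fun ω => ?_⟩
    beta_reduce
    rw [if_pos h0]
    refine (pow_le_pow_left₀ (norm_nonneg _) (hKd _ (U h k _).2 u huR _ hkh) 2).trans ?_
    rw [mul_pow, NNReal.coe_mul, NNReal.coe_pow, mul_assoc]
    exact mul_le_mul_of_nonneg_left (hest ω) (sq_nonneg _)
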